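/- **Setting.** Let $d\ge 2$, $m>0$, $M=\mathbb{R}\times\mathbb{R}^{d-1}$ ($d$-dimensional Minkowski spacetime, points $x=(t,\mathbf x)$), and $\omega_{\mathbf p}=\sqrt{|\mathbf p|^2+m^2}$. Let $$\Delta_+(t,\mathbf x)=\frac1{(2\pi)^{d-1}}\int_{\mathbb{R}^{d-1}}\frac{1}{2\omega_{\mathbf p}}\,e^{i\mathbf p\cdot\mathbf x-i\omega_{\mathbf p}t}\,d\mathbf p$$ (a distribution) be the vacuum two-point function of the free scalar field of mass $m$. Put $\Delta_+(f,g)=\int\!\!\int f(x)\Delta_+(x-y)g(y)\,dx\,dy$ and $\Delta(f,g)=2\,\mathrm{Im}\,\Delta_+(f,g)$ for $f,g\in C_0^\infty(M;\mathbb{R})$. Let $\mathcal W_0$ be the Weyl $*$-algebra spanned by generators $W(h)$, $h\in C_0^\infty(M;\mathbb{R})$, with $W(f)W(g)=e^{-\frac i2\Delta(f,g)}W(f+g)$ and $W(h)^*=W(-h)$. Let $\omega$ be the vacuum state, $\omega(W(h))=e^{-\frac12\Delta_+(h,h)}$, and $(\mathcal H,\pi,\Psi)$ its GNS triple. **Regularization.**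 Let $\chi\in C_0^\infty(\mathbb{R}^{d-1})$ be nonnegative, symmetric ($\chi(-\mathbf x)=\chi(\mathbf x)$), with $\int\chi=1$ and Fourier transform $\hat\chi$. For $\Lambda>0$ let $$\Delta_{+,\Lambda}(t,\mathbf x)=\frac1{(2\pi)^{d-1}}\int\frac{1}{2\omega_{\mathbf p}}e^{i\mathbf p\cdot\mathbf x-i\omega_{\mathbf p}t}\hat\chi(\Lambda\mathbf p)^2\,d\mathbf p,\qquad \Delta_{F,\Lambda}(t,\mathbf x)=\theta(t)\Delta_{+,\Lambda}(t,\mathbf x)+\theta(-t)\Delta_{+,\Lambda}(-t,\mathbf x).$$ Let $r_\Lambda F(\phi)=F(G_\Lambda*\phi)$ with $G_\Lambda(t,\mathbf x)=\delta(t)\Lambda^{-(d-1)}\chi(\mathbf x/\Lambda)$. **Interaction.** Let $g\in C_0^\infty(M;\mathbb{R})$, and let $f:\mathbb{R}\to\mathbb{C}$ be a Schwartz function with $\overline{f(a)}=f(-a)$ and $$\int_{\mathbb{R}}|f(a)|\,e^{\frac{a^2}{2}W}\,da<\infty,\qquad W=\mathrm{Re}\,\Delta_{+,\Lambda}(0)$$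 (for instance $f\in C_0^\infty(\mathbb{R})$). For $L_I(f,g)=\int_{\mathbb{R}}\int_M e^{ia\phi(x)}f(a)g(x)\,dx\,da$, the term of order $n$ of the regularized S-matrix $S_\Lambda(L_I)=\sum_n S_{\Lambda,n}(L_I)$ is the functional $$S_{\Lambda,n}(L_I)(\phi)=\frac{i^n}{n!}\int_{\mathbb{R}^n}\prod_{j=1}^n f(a_j)\int_{M^n}\prod_{j=1}^n e^{ia_j\phi(x_j)}g(x_j)\;e^{-\sum_{l<j}a_la_j\Delta_{F,\Lambda}(x_l-x_j)}\,dx\,da .$$ **Representation.** A bounded operator $A$ on $\mathcal H$ is said to represent a functional $F$, written $A=\pi(F)$, if for all $h,k\in C_0^\infty(M;\mathbb{R})$ $$\langle\pi(W(k))\Psi,\,A\,\pi(W(h))\Psi\rangle=\big(W_+(k)^*\star F\star W_+(h)\big)(\phi)\big|_{\phi=0},\qquad W_+(h)(\phi)=e^{i\int h\phi}\,e^{-\frac12\Delta_+(h,h)},$$ where $\star$ is the product $F\star G=\mathcal M\exp\big(\int\!\!\int\Delta_+(x-y)\frac{\delta}{\delta\phi(x)}\otimes\frac{\delta}{\delta\phi(y)}dx\,dy\big)(F\otimes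 G)$ and $\mathcal M$ restricts a functional of $(\phi_1,\phi_2)$ to $\phi_1=\phi_2=\phi$. Products with Weyl functionals are shifts: $(F\star W_+(h))(\phi)=F(\phi+i\Delta_+h)\,W_+(h)(\phi)$ and $(W_+(h)\star F)(\phi)=W_+(h)(\phi)\,F(\phi+ih\Delta_+)$, with $(\Delta_+h)(x)=\int\Delta_+(x-y)h(y)\,dy$ and $(h\Delta_+)(y)=\int h(x)\Delta_+(x-y)\,dx$, where the functionals in question are evaluated on complex configurations by the same formulas. **Theorem.** For every $n$ there is exactly one bounded operator $\pi(r_\Lambda S_{\Lambda,n}(L_I))$ on $\mathcal H$ that represents $r_\Lambda S_{\Lambda,n}(L_I)$, and the series $\sum_{n\ge0}\pi(r_\Lambda S_{\Lambda,n}(L_I))$ converges in the strong operator topology to a unitary operator on $\mathcal H$. -/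

import Mathlib

open MeasureTheory
open scoped ContDiff Distributions SchwartzMap InnerProductSpace ComplexConjugate

noncomputable section

namespace ScalarQFT

open Complex
open scoped FourierTransform

/-! ### Spacetime and the one-particle structure of the free field -/

/-- Space `ℝ^(d-1)`, with its Euclidean norm. -/
abbrev Space (d : ℕ) := EuclideanSpace ℝ (Fin (d - 1))

/-- `d`-dimensional Minkowski spacetime; a point is `(t, 𝐱)`. -/
abbrev Minkowski (d : ℕ) := ℝ × Space d

/-- Real test functions `C₀^∞(M; ℝ)`. -/
abbrev TestFn (d : ℕ) := 𝓓((⊤ : TopologicalSpace.Opens (Minkowski d)), ℝ)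

/-- `ω_𝐩 = √(|𝐩|² + m²)`. -/
def energy {d : ℕ} (m : ℝ) (p : Space d) : ℝ := √(‖p‖ ^ 2 + m ^ 2)

/-- `𝐩·𝐱 - ω_𝐩 t`. -/
def phaseArg {d : ℕ} (m : ℝ) (p : Space d) (x : Minkowski d) : ℝ :=
  ⟪p, x.2⟫_ℝ - energy m p * x.1

/-- Restriction to the mass shell of the Fourier transform of a test function,
`ĥ(ω_𝐩, 𝐩) = ∫ e^{iω_𝐩 t - i𝐩·𝐱} h(t, 𝐱) dt d𝐱`. -/
def shell {d : ℕ} (m : ℝ) (h : TestFn d) (p : Space d) : ℂ :=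
  ∫ x : Minkowski d, cexp (-I * phaseArg m p x) * h x

/-- The density `(2π)^{-(d-1)} / (2ω_𝐩)`. -/
def modeWeight (d : ℕ) (m : ℝ) (p : Space d) : ℝ :=
  1 / ((2 * Real.pi) ^ (d - 1) * (2 * energy m p))

/-- The two-point function of the vacuum smeared with two real test functions,
`Δ₊(f, g) = ∫∫ f(x) Δ₊(x - y) g(y) dx dy`, where
`Δ₊(t, 𝐱) = (2π)^{-(d-1)} ∫ (2ω_𝐩)⁻¹ e^{i𝐩·𝐱 - iω_𝐩 t} d𝐩` as a distribution. -/
def twoPoint {d : ℕ} (m : ℝ) (f g : TestFn d) : ℂ :=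
  ∫ p : Space d, modeWeight d m p * (conj (shell m f p) * shell m g p)

/-- Auxiliary: a test function as a Schwartz function on the Euclidean space `ℝ × ℝ^(d-1)`. -/
def toW {d : ℕ} (h : TestFn d) : 𝓢(WithLp 2 (Minkowski d), ℂ) :=
  HasCompactSupport.toSchwartzMap (f := fun w => ((h (WithLp.ofLp w) : ℝ) : ℂ)) (by
    have : HasCompactSupport (fun w : WithLp 2 (Minkowski d) => h (WithLp.ofLp w)) :=
      h.hasCompactSupport.comp_homeomorph (WithLp.prodContinuousLinearEquiv 2 ℝ ℝ (Space d)).toHomeomorph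
    exact this.comp_left (g := fun r : ℝ => (r : ℂ)) (by simp)) (by
    exact Complex.ofRealCLM.contDiff.comp (h.contDiff.comp (WithLp.prodContinuousLinearEquiv 2 ℝ ℝ (Space d)).contDiff))

/-- Auxiliary: the point of the (negative) mass shell over `𝐩`, scaled by `1 / 2π`. -/
def shellPt {d : ℕ} (m : ℝ) (p : Space d) : WithLp 2 (Minkowski d) :=
  WithLp.toLp 2 (-(energy m p) / (2 * Real.pi), (1 / (2 * Real.pi)) • p)

lemma shell_eq {d : ℕ} (m : ℝ) (h : TestFn d) (p : Space d) :
    shell m h p = 𝓕 (toW h) (shellPt m p) := by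
  rw [SchwartzMap.fourier_coe, Real.fourier_eq']
  unfold shell
  rw [← (WithLp.volume_preserving_symm_measurableEquiv_toLp_prod ℝ (Space d)).integral_comp
    (MeasurableEquiv.toLp 2 (ℝ × Space d)).symm.measurableEmbedding]
  refine integral_congr_ae (Filter.Eventually.of_forall fun w => ?_)
  have h1 : (toW h) w = ((h (WithLp.ofLp w) : ℝ) : ℂ) := rfl
  have h2 : ⟪w, shellPt m p⟫_ℝ = (1 / (2 * Real.pi)) * phaseArg m p (WithLp.ofLp w) := by
    simp only [shellPt, phaseArg, WithLp.prod_inner_apply, inner_smul_right, real_inner_comm]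
    simp
    ring
  have h3 : (MeasurableEquiv.toLp 2 (ℝ × Space d)).symm w = WithLp.ofLp w := rfl
  simp only [h1, h2, h3, smul_eq_mul]
  congr 2
  have : (Real.pi : ℂ) ≠ 0 := by exact_mod_cast Real.pi_ne_zero
  push_cast
  field_simp

lemma shell_continuous {d : ℕ} (m : ℝ) (h : TestFn d) : Continuous (shell m h) := by
  have : shell m h = fun p => 𝓕 (toW h) (shellPt m p) := funext (shell_eq m h)
  rw [this]
  refine (SchwartzMap.continuous _).comp ?_
  refine (WithLp.prod_continuous_toLp 2 ℝ (Space d)).comp ?_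
  unfold energy
  fun_prop

lemma shell_decay {d : ℕ} (m : ℝ) (h : TestFn d) (k : ℕ) :
    ∃ C : ℝ, 0 ≤ C ∧ ∀ p, (1 + ‖p‖) ^ k * ‖shell m h p‖ ≤ C := by
  obtain ⟨C, hC⟩ : ∃ C : ℝ, ∀ w, (1 + ‖w‖) ^ k * ‖𝓕 (toW h) w‖ ≤ C := by
    have key := SchwartzMap.one_add_le_sup_seminorm_apply (𝕜 := ℝ) (m := (k, 0))
      (k := k) (n := 0) le_rfl le_rfl (𝓕 (toW h))
    simp only [norm_iteratedFDeriv_zero] at key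
    exact ⟨_, key⟩
  have hC0 : 0 ≤ C := le_trans (by positivity) (hC 0)
  refine ⟨(2 * Real.pi) ^ k * C, by positivity, fun p => ?_⟩
  have hp : 1 + ‖p‖ ≤ 2 * Real.pi * (1 + ‖shellPt m p‖) := by
    have h1 : ‖(1 / (2 * Real.pi)) • p‖ ≤ ‖shellPt m p‖ :=
      WithLp.norm_snd_le _ (shellPt m p)
    rw [norm_smul, Real.norm_of_nonneg (by positivity)] at h1
    have h2 := mul_le_mul_of_nonneg_left h1 (show 0 ≤ 2 * Real.pi by positivity)
    have h3 : 2 * Real.pi * (1 / (2 * Real.pi) * ‖p‖) = ‖p‖ := by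
      field_simp
    have := Real.pi_gt_three
    nlinarith
  calc (1 + ‖p‖) ^ k * ‖shell m h p‖
      ≤ (2 * Real.pi * (1 + ‖shellPt m p‖)) ^ k * ‖shell m h p‖ := by gcongr
    _ = (2 * Real.pi) ^ k * ((1 + ‖shellPt m p‖) ^ k * ‖𝓕 (toW h) (shellPt m p)‖) := by
        rw [shell_eq, mul_pow, mul_assoc]
    _ ≤ _ := by gcongr; exact hC _

lemma energy_ge {d : ℕ} (m : ℝ) (p : Space d) : m ≤ energy m p :=
  Real.le_sqrt_of_sq_le (by nlinarith [sq_nonneg ‖p‖])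

lemma energy_continuous {d : ℕ} (m : ℝ) : Continuous (energy (d := d) m) := by
  unfold energy; fun_prop

lemma modeWeight_nonneg {d : ℕ} (m : ℝ) (p : Space d) : 0 ≤ modeWeight d m p := by
  unfold modeWeight energy; positivity

lemma twoPoint_integrable {d : ℕ} {m : ℝ} (hm : 0 < m) (f g : TestFn d) :
    Integrable fun p : Space d => (modeWeight d m p : ℂ) * (conj (shell m f p) * shell m g p) := by
  obtain ⟨C, hC0, hC⟩ := shell_decay m f (d + 1)
  obtain ⟨D, hD0, hD⟩ := shell_decay m g 0
  have hint := (integrable_one_add_norm (E := Space d) (μ := volume) (r := ((d + 1 : ℕ) : ℝ)) (by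
    rw [finrank_euclideanSpace_fin]; exact_mod_cast (by omega : d - 1 < d + 1))).const_mul
      (1 / ((2 * Real.pi) ^ (d - 1) * (2 * m)) * (C * D))
  refine hint.mono' ?_ (Filter.Eventually.of_forall fun p => ?_)
  · have h1 := shell_continuous m f
    have h2 := shell_continuous m g
    have h3 : Measurable (fun p : Space d => modeWeight d m p) := by
      unfold modeWeight
      exact measurable_const.div (measurable_const.mul
        (measurable_const.mul (energy_continuous m).measurable))
    exact ((Complex.measurable_ofReal.comp h3).mul
      ((Complex.continuous_conj.comp h1).mul h2).measurable).aestronglyMeasurable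
  · have hw : modeWeight d m p ≤ 1 / ((2 * Real.pi) ^ (d - 1) * (2 * m)) := by
      unfold modeWeight
      have := energy_ge m p
      gcongr
    have hf : ‖shell m f p‖ ≤ C * (1 + ‖p‖) ^ (-((d + 1 : ℕ) : ℝ)) := by
      rw [Real.rpow_neg (by positivity), Real.rpow_natCast, ← div_eq_mul_inv,
        le_div_iff₀ (by positivity), mul_comm]
      exact hC p
    have hg : ‖shell m g p‖ ≤ D := by simpa using hD p
    rw [norm_mul, norm_mul, RCLike.norm_conj, Complex.norm_of_nonneg (modeWeight_nonneg m p)]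
    calc modeWeight d m p * (‖shell m f p‖ * ‖shell m g p‖)
        ≤ 1 / ((2 * Real.pi) ^ (d - 1) * (2 * m)) * (C * (1 + ‖p‖) ^ (-((d + 1 : ℕ) : ℝ)) * D) := by
          gcongr
      _ = _ := by ring

lemma shell_add {d : ℕ} (m : ℝ) (f g : TestFn d) (p : Space d) :
    shell m (f + g) p = shell m f p + shell m g p := by
  have hi : ∀ h : TestFn d, Integrable fun x : Minkowski d => cexp (-I * phaseArg m p x) * h x := by
    intro h
    refine Continuous.integrable_of_hasCompactSupport ?_ ?_
    · have := h.continuous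
      unfold phaseArg
      fun_prop
    · exact (h.hasCompactSupport.comp_left (g := fun r : ℝ => (r : ℂ)) (by simp)).mul_left
  unfold shell
  rw [← integral_add (hi f) (hi g)]
  refine integral_congr_ae (Filter.Eventually.of_forall fun x => ?_)
  simp [mul_add]

lemma twoPoint_add_left {d : ℕ} {m : ℝ} (hm : 0 < m) (f g k : TestFn d) :
    twoPoint m (f + g) k = twoPoint m f k + twoPoint m g k := by
  unfold twoPoint
  rw [← integral_add (twoPoint_integrable hm f k) (twoPoint_integrable hm g k)]
  refine integral_congr_ae (Filter.Eventually.of_forall fun p => ?_)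
  simp [shell_add]; ring

lemma twoPoint_conj {d : ℕ} (m : ℝ) (f g : TestFn d) :
    conj (twoPoint m f g) = twoPoint m g f := by
  unfold twoPoint
  rw [← integral_conj]
  refine integral_congr_ae (Filter.Eventually.of_forall fun p => ?_)
  simp [mul_comm]

lemma twoPoint_add_right {d : ℕ} {m : ℝ} (hm : 0 < m) (f g k : TestFn d) :
    twoPoint m f (g + k) = twoPoint m f g + twoPoint m f k := by
  rw [← twoPoint_conj, twoPoint_add_left hm, map_add, twoPoint_conj, twoPoint_conj]

lemma twoPoint_neg_left {d : ℕ} {m : ℝ} (hm : 0 < m) (f g : TestFn d) :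
    twoPoint m (-f) g = -twoPoint m f g := by
  have h0 : twoPoint m (0 : TestFn d) g = 0 := by
    have := twoPoint_add_left hm 0 0 g
    simpa using this
  have := twoPoint_add_left hm f (-f) g
  rw [add_neg_cancel, h0] at this
  exact (neg_eq_of_add_eq_zero_right this.symm).symm

lemma twoPoint_neg_right {d : ℕ} {m : ℝ} (hm : 0 < m) (f g : TestFn d) :
    twoPoint m f (-g) = -twoPoint m f g := by
  rw [← twoPoint_conj, twoPoint_neg_left hm, map_neg, twoPoint_conj]


/-! ### The Weyl algebra -/

/-- The causal propagator `Δ(f, g)`: the two-point function is `Δ₊ = Δ_s + (i/2) Δ` with real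
symmetric `Δ_s`. -/
def causalProp {d : ℕ} (m : ℝ) (f g : TestFn d) : ℝ := 2 * (twoPoint m f g).im

/-- The Weyl cocycle `e^{-(i/2) Δ(f, g)}`. -/
def weylPhase {d : ℕ} (m : ℝ) (f g : TestFn d) : ℂ := cexp (-(I / 2) * causalProp m f g)

lemma causalProp_add_left {d : ℕ} {m : ℝ} (hm : 0 < m) (f g k : TestFn d) :
    causalProp m (f + g) k = causalProp m f k + causalProp m g k := by
  simp [causalProp, twoPoint_add_left hm, mul_add]

lemma causalProp_add_right {d : ℕ} {m : ℝ} (hm : 0 < m) (f g k : TestFn d) :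
    causalProp m f (g + k) = causalProp m f g + causalProp m f k := by
  simp [causalProp, twoPoint_add_right hm, mul_add]

lemma causalProp_swap {d : ℕ} (m : ℝ) (f g : TestFn d) :
    causalProp m g f = -causalProp m f g := by
  simp [causalProp, ← twoPoint_conj m f g]

lemma causalProp_neg_neg {d : ℕ} {m : ℝ} (hm : 0 < m) (f g : TestFn d) :
    causalProp m (-f) (-g) = causalProp m f g := by
  simp [causalProp, twoPoint_neg_left hm, twoPoint_neg_right hm]

lemma causalProp_zero_left {d : ℕ} {m : ℝ} (hm : 0 < m) (f : TestFn d) :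
    causalProp m 0 f = 0 := by
  simpa using causalProp_add_left hm 0 0 f

lemma causalProp_zero_right {d : ℕ} {m : ℝ} (hm : 0 < m) (f : TestFn d) :
    causalProp m f 0 = 0 := by
  simpa using causalProp_add_right hm f 0 0

set_option linter.unusedVariables false in
/-- The Weyl `*`-algebra `𝒲₀` of the free field of mass `m`: it has the Weyl generators `W(h)` as a
linear basis, with `W(f) W(g) = e^{-(i/2) Δ(f, g)} W(f + g)` and `W(h)* = W(-h)`. -/
def WeylAlgebra (d : ℕ) {m : ℝ} (hm : 0 < m) : Type := TestFn d →₀ ℂ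

namespace WeylAlgebra

variable {d : ℕ} {m : ℝ} {hm : 0 < m}

instance : AddCommGroup (WeylAlgebra d hm) := inferInstanceAs (AddCommGroup (TestFn d →₀ ℂ))
instance : Module ℂ (WeylAlgebra d hm) := inferInstanceAs (Module ℂ (TestFn d →₀ ℂ))

/-- The Weyl generator. -/
def W (hm : 0 < m) (h : TestFn d) : WeylAlgebra d hm := Finsupp.single h (1 : ℂ)

lemma induction_W {P : WeylAlgebra d hm → Prop} (a : WeylAlgebra d hm)
    (hz : P 0) (ha : ∀ a b, P a → P b → P (a + b)) (hW : ∀ (c : ℂ) (h : TestFn d), P (c • W hm h)) :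
    P a := by
  refine Finsupp.induction_linear (motive := P) a hz (fun f g => ha f g) fun h c => ?_
  have := hW c h
  unfold W at this
  erw [Finsupp.smul_single, smul_eq_mul, mul_one] at this
  exact this

/-- The product. -/
def mulHom (d : ℕ) (hm : 0 < m) : WeylAlgebra d hm →ₗ[ℂ] WeylAlgebra d hm →ₗ[ℂ] WeylAlgebra d hm :=
  Finsupp.linearCombination ℂ fun f : TestFn d =>
    (Finsupp.linearCombination ℂ fun g : TestFn d => weylPhase m f g • W hm (f + g) :
      (TestFn d →₀ ℂ) →ₗ[ℂ] WeylAlgebra d hm)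

lemma mulHom_W (f g : TestFn d) :
    mulHom d hm (W hm f) (W hm g) = weylPhase m f g • W hm (f + g) := by
  unfold mulHom
  conv_lhs => unfold W
  erw [Finsupp.linearCombination_single]
  erw [one_smul, Finsupp.linearCombination_single, one_smul]
  rfl

/-- The involution. -/
def starHom (d : ℕ) (hm : 0 < m) : WeylAlgebra d hm →ₗ⋆[ℂ] WeylAlgebra d hm where
  toFun a := Finsupp.mapDomain (fun h : TestFn d => -h) (Finsupp.mapRange (starRingEnd ℂ) (map_zero _) a)
  map_add' a b := by
    erw [Finsupp.mapRange_add (by simp)]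
    exact Finsupp.mapDomain_add
  map_smul' c a := by
    erw [Finsupp.mapRange_smul' (c := c) (d := conj c) a (by simp)]
    exact Finsupp.mapDomain_smul _ _

lemma starHom_W (f : TestFn d) : starHom d hm (W hm f) = W hm (-f) := by
  show Finsupp.mapDomain _ (Finsupp.mapRange _ _ (Finsupp.single f (1 : ℂ))) = Finsupp.single (-f) (1 : ℂ)
  rw [Finsupp.mapRange_single, Finsupp.mapDomain_single]
  simp

instance : Mul (WeylAlgebra d hm) := ⟨fun a b => mulHom d hm a b⟩
instance : One (WeylAlgebra d hm) := ⟨W hm 0⟩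
instance : Star (WeylAlgebra d hm) := ⟨starHom d hm⟩

lemma mul_def (a b : WeylAlgebra d hm) : a * b = mulHom d hm a b := rfl
lemma one_def : (1 : WeylAlgebra d hm) = W hm 0 := rfl
lemma star_def (a : WeylAlgebra d hm) : star a = starHom d hm a := rfl

lemma W_mul_W (f g : TestFn d) : W hm f * W hm g = weylPhase m f g • W hm (f + g) := mulHom_W f g

lemma star_W (f : TestFn d) : star (W hm f) = W hm (-f) := starHom_W f

lemma mul_assoc_aux (a b c : WeylAlgebra d hm) : a * b * c = a * (b * c) := by
  simp only [mul_def]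
  induction a using induction_W with
  | hz => simp
  | ha a a' h h' => simp [h, h']
  | hW x f =>
    induction b using induction_W with
    | hz => simp
    | ha b b' h h' => simp only [map_add, LinearMap.add_apply, h, h']
    | hW y g =>
      induction c using induction_W with
      | hz => simp
      | ha c c' h h' => simp only [map_add, h, h']
      | hW z k =>
        simp only [map_smul, LinearMap.smul_apply, mulHom_W, smul_smul, add_assoc]
        congr 1
        have : weylPhase m f g * weylPhase m (f + g) k
            = weylPhase m g k * weylPhase m f (g + k) := by
          simp only [weylPhase, ← Complex.exp_add, causalProp_add_left hm, causalProp_add_right hm]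
          congr 1
          push_cast; ring
        linear_combination x * y * z * this

instance : Ring (WeylAlgebra d hm) where
  __ := (inferInstance : AddCommGroup (WeylAlgebra d hm))
  left_distrib a b c := by simp [mul_def]
  right_distrib a b c := by simp [mul_def]
  zero_mul a := by simp [mul_def]
  mul_zero a := by simp [mul_def]
  mul_assoc := mul_assoc_aux
  one_mul a := by
    simp only [mul_def, one_def]
    induction a using induction_W with
    | hz => simp
    | ha a b h h' => simp [h, h']
    | hW c f => simp [mulHom_W, weylPhase, causalProp_zero_left hm]
  mul_one a := by
    simp only [mul_def, one_def]
    induction a using induction_W with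
    | hz => simp
    | ha a b h h' => simp [h, h']
    | hW c f => simp [mulHom_W, weylPhase, causalProp_zero_right hm]

instance : Algebra ℂ (WeylAlgebra d hm) :=
  Algebra.ofModule (fun r x y => by simp [mul_def]) (fun r x y => by simp [mul_def])

lemma conj_weylPhase (f g : TestFn d) : conj (weylPhase m f g) = weylPhase m g f := by
  rw [weylPhase, weylPhase, ← Complex.exp_conj, causalProp_swap m f g]
  congr 1
  simp [Complex.conj_ofNat]
  ring

instance : StarRing (WeylAlgebra d hm) where
  star_involutive a := by
    simp only [star_def]
    induction a using induction_W with
    | hz => simp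
    | ha a b h h' => simp [h, h']
    | hW c f => simp [starHom_W]
  star_add a b := by simp [star_def]
  star_mul a b := by
    simp only [star_def, mul_def]
    induction a using induction_W with
    | hz => simp
    | ha a a' h h' => simp [h, h']
    | hW x f =>
      induction b using induction_W with
      | hz => simp
      | ha b b' h h' => simp only [map_add, LinearMap.add_apply, h, h']
      | hW y g =>
        simp only [map_smulₛₗ, LinearMap.smul_apply, mulHom_W, starHom_W, smul_smul, RingHom.id_apply,
          map_mul, conj_weylPhase]
        rw [show weylPhase m (-g) (-f) = weylPhase m g f by
          simp only [weylPhase, causalProp_neg_neg hm], neg_add_rev]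
        congr 1
        ring

instance : StarModule ℂ (WeylAlgebra d hm) where
  star_smul c a := by simp [star_def]

end WeylAlgebra

/-- The vacuum: `ω(W(h)) = e^{-Δ₊(h, h)/2}`. -/
def vacuumState (d : ℕ) {m : ℝ} (hm : 0 < m) : WeylAlgebra d hm →ₗ[ℂ] ℂ :=
  Finsupp.linearCombination ℂ fun h : TestFn d => cexp (-(1 / 2) * twoPoint m h h)

lemma vacuumState_W {d : ℕ} {m : ℝ} (hm : 0 < m) (h : TestFn d) :
    vacuumState d hm (WeylAlgebra.W hm h) = cexp (-(1 / 2) * twoPoint m h h) := by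
  unfold vacuumState WeylAlgebra.W
  erw [Finsupp.linearCombination_single, one_smul]


/-! ### The GNS representation -/

/-- A GNS triple `(H, π, Ψ)` of a linear functional on a `*`-algebra: a `*`-representation by bounded
operators with a cyclic vector that implements the functional. -/
structure GNSTriple {A : Type*} [Ring A] [StarRing A] [Algebra ℂ A] (state : A →ₗ[ℂ] ℂ)
    (H : Type*) [NormedAddCommGroup H] [InnerProductSpace ℂ H] [CompleteSpace H] where
  rep : A →⋆ₐ[ℂ] (H →L[ℂ] H)
  vac : H
  inner_rep : ∀ a, ⟪vac, rep a vac⟫_ℂ = state a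
  cyclic : Dense (Set.range fun a => rep a vac)

open scoped ComplexOrder

lemma twoPoint_posSemidef {d : ℕ} {m : ℝ} (hm : 0 < m) :
    Matrix.PosSemidef (Matrix.of fun f g : TestFn d => twoPoint m f g) := by
  refine ⟨Matrix.ext fun f g => twoPoint_conj m g f, fun x => ?_⟩
  have key : (x.sum fun i xi => x.sum fun j xj => star xi * twoPoint m i j * xj)
      = ∫ p : Space d, ((modeWeight d m p * Complex.normSq (x.sum fun i xi => xi * shell m i p) : ℝ) : ℂ) := by
    simp only [Finsupp.sum, twoPoint]
    simp_rw [← integral_const_mul, ← integral_mul_const]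
    have hi : ∀ i j, Integrable fun p : Space d =>
        star (x i) * (modeWeight d m p * (conj (shell m i p) * shell m j p)) * x j :=
      fun i j => ((twoPoint_integrable hm i j).const_mul _).mul_const _
    have h1 : ∀ i ∈ x.support, (∑ j ∈ x.support, ∫ p : Space d,
        star (x i) * (modeWeight d m p * (conj (shell m i p) * shell m j p)) * x j)
        = ∫ p : Space d, ∑ j ∈ x.support,
          star (x i) * (modeWeight d m p * (conj (shell m i p) * shell m j p)) * x j :=
      fun i _ => (integral_finsetSum _ fun j _ => hi i j).symm
    rw [Finset.sum_congr rfl h1, ← integral_finsetSum _ fun i _ => integrable_finsetSum _ fun j _ => hi i j]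
    refine integral_congr_ae (Filter.Eventually.of_forall fun p => ?_)
    simp only [Complex.ofReal_mul, Complex.normSq_eq_conj_mul_self, map_sum, map_mul]
    rw [Finset.sum_mul_sum, Finset.mul_sum]
    refine Finset.sum_congr rfl fun i _ => ?_
    rw [Finset.mul_sum]
    refine Finset.sum_congr rfl fun j _ => ?_
    simp only [← starRingEnd_apply]
    ring
  simp only [Matrix.of_apply]
  rw [key, integral_complex_ofReal]
  exact_mod_cast integral_nonneg fun p => mul_nonneg (modeWeight_nonneg m p) (Complex.normSq_nonneg _)

lemma exp_posSemidef {d : ℕ} {m : ℝ} (hm : 0 < m) :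
    Matrix.PosSemidef (Matrix.of fun f g : TestFn d => cexp (twoPoint m f g)) := by
  have hpow : ∀ k : ℕ, Matrix.PosSemidef
      (Matrix.of fun f g : TestFn d => (twoPoint m f g) ^ k) := by
    intro k
    induction k with
    | zero =>
      refine ⟨Matrix.ext fun f g => by simp, fun x => ?_⟩
      have : (x.sum fun i xi => x.sum fun j xj =>
          star xi * (Matrix.of fun f g : TestFn d => (twoPoint m f g) ^ 0) i j * xj)
          = star (x.sum fun i xi => xi) * (x.sum fun i xi => xi) := by
        simp only [Finsupp.sum, star_sum, Finset.sum_mul_sum, Matrix.of_apply, pow_zero, mul_one]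
      rw [this]
      exact star_mul_self_nonneg _
    | succ k ih =>
      have := ih.hadamard (twoPoint_posSemidef (d := d) hm)
      convert! this using 1
  refine ⟨Matrix.ext fun f g => ?_, fun x => ?_⟩
  · simp only [Matrix.conjTranspose_apply, Matrix.of_apply, ← starRingEnd_apply]
    rw [← Complex.exp_conj, twoPoint_conj]
  · have hlim : Filter.Tendsto (fun N : ℕ => x.sum fun i xi => x.sum fun j xj =>
        star xi * (∑ k ∈ Finset.range N, (twoPoint m i j) ^ k / (k.factorial : ℂ)) * xj) Filter.atTop
        (nhds (x.sum fun i xi => x.sum fun j xj => star xi * cexp (twoPoint m i j) * xj)) := by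
      refine tendsto_finsetSum _ fun i _ => tendsto_finsetSum _ fun j _ => ?_
      refine Filter.Tendsto.mul_const _ (Filter.Tendsto.const_mul _ ?_)
      rw [Complex.exp_eq_exp_ℂ]
      exact (NormedSpace.expSeries_div_hasSum_exp (twoPoint m i j)).tendsto_sum_nat
    refine ge_of_tendsto' hlim fun N => ?_
    have : (x.sum fun i xi => x.sum fun j xj =>
        star xi * (∑ k ∈ Finset.range N, (twoPoint m i j) ^ k / (k.factorial : ℂ)) * xj)
        = ∑ k ∈ Finset.range N, ((k.factorial : ℂ))⁻¹ * (x.sum fun i xi => x.sum fun j xj =>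
            star xi * (twoPoint m i j) ^ k * xj) := by
      simp only [Finsupp.sum, Finset.mul_sum, Finset.sum_mul]
      rw [Finset.sum_congr rfl fun i _ => Finset.sum_comm, Finset.sum_comm]
      refine Finset.sum_congr rfl fun k _ => Finset.sum_congr rfl fun i _ =>
        Finset.sum_congr rfl fun j _ => ?_
      ring
    rw [this]
    refine Finset.sum_nonneg fun k _ => mul_nonneg ?_ ((hpow k).2 x)
    rw [← Complex.ofReal_natCast, ← Complex.ofReal_inv]
    exact_mod_cast (by positivity : (0:ℝ) ≤ ((k.factorial : ℝ))⁻¹)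


namespace WeylAlgebra

variable {d : ℕ} {m : ℝ} {hm : 0 < m}

lemma state_star_W_mul_W (f g : TestFn d) :
    vacuumState d hm (star (W hm f) * W hm g)
      = conj (cexp (-(1 / 2) * twoPoint m f f)) * cexp (twoPoint m f g)
        * cexp (-(1 / 2) * twoPoint m g g) := by
  rw [star_W, W_mul_W, map_smul, vacuumState_W, smul_eq_mul, weylPhase, ← Complex.exp_conj,
    ← Complex.exp_add, ← Complex.exp_add, ← Complex.exp_add]
  congr 1
  have h1 : (((twoPoint m f g).im : ℝ) : ℂ) * I = (twoPoint m f g - twoPoint m g f) / 2 := by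
    rw [← twoPoint_conj m f g, Complex.sub_conj]
    push_cast
    ring
  simp only [causalProp, twoPoint_neg_left hm, twoPoint_neg_right hm, twoPoint_add_left hm,
    twoPoint_add_right hm, map_mul, map_neg, twoPoint_conj, Complex.neg_im, Complex.ofReal_mul,
    Complex.ofReal_neg, map_div₀, map_one, Complex.conj_ofNat, Complex.ofReal_ofNat]
  linear_combination h1

lemma eq_sum_W (a : WeylAlgebra d hm) :
    ∃ (s : Finset (TestFn d)) (x : TestFn d → ℂ), a = ∑ f ∈ s, x f • W hm f := by
  let b : TestFn d →₀ ℂ := a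
  refine ⟨b.support, fun f => b f, ?_⟩
  have h : ∀ f : TestFn d, b f • W hm f = (Finsupp.single f (b f) : TestFn d →₀ ℂ) := by
    intro f
    unfold W
    erw [Finsupp.smul_single, smul_eq_mul, mul_one]
  rw [Finset.sum_congr rfl fun f _ => h f]
  exact (Finsupp.sum_single b).symm

lemma state_star_mul_self_nonneg (a : WeylAlgebra d hm) :
    0 ≤ vacuumState d hm (star a * a) := by
  obtain ⟨s, x, rfl⟩ := eq_sum_W a
  classical
  let y : TestFn d →₀ ℂ := Finsupp.onFinset s
    (fun f => if f ∈ s then x f * cexp (-(1 / 2) * twoPoint m f f) else 0)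
    (by intro f hf; by_contra hs; simp [hs] at hf)
  have hy : ∀ f ∈ s, y f = x f * cexp (-(1 / 2) * twoPoint m f f) := fun f hf => by
    simp [y, hf]
  have hys : y.support ⊆ s := Finsupp.support_onFinset_subset
  have h := (exp_posSemidef (d := d) hm).2 y
  rw [Finsupp.sum_of_support_subset _ hys _ (by simp)] at h
  have e : ∀ i, y.sum (fun j yj => star (y i) * (Matrix.of fun f g : TestFn d =>
      cexp (twoPoint m f g)) i j * yj) = ∑ j ∈ s, star (y i) * cexp (twoPoint m i j) * y j :=
    fun i => Finsupp.sum_of_support_subset _ hys _ (by simp)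
  rw [Finset.sum_congr rfl fun i _ => e i] at h
  convert h using 1
  simp only [star_sum, star_smul, Finset.sum_mul_sum, smul_mul_smul_comm, map_sum, map_smul,
    state_star_W_mul_W]
  refine Finset.sum_congr rfl fun i hi => Finset.sum_congr rfl fun j hj => ?_
  rw [hy i hi, hy j hj]
  simp only [smul_eq_mul, ← starRingEnd_apply, map_mul]
  ring

lemma state_star (a b : WeylAlgebra d hm) :
    conj (vacuumState d hm (star a * b)) = vacuumState d hm (star b * a) := by
  obtain ⟨s, x, rfl⟩ := eq_sum_W a
  obtain ⟨t, y, rfl⟩ := eq_sum_W b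
  simp only [star_sum, star_smul, Finset.sum_mul_sum, smul_mul_smul_comm, map_sum, map_smul,
    state_star_W_mul_W, smul_eq_mul, map_mul, Complex.conj_conj]
  rw [Finset.sum_comm]
  refine Finset.sum_congr rfl fun i hi => Finset.sum_congr rfl fun j hj => ?_
  simp only [← starRingEnd_apply, Complex.conj_conj, ← Complex.exp_conj (twoPoint m _ _),
    twoPoint_conj]
  ring

lemma star_W_mul_W_self (f : TestFn d) : star (W hm f) * W hm f = 1 := by
  rw [star_W, W_mul_W, neg_add_cancel, one_def]
  have : weylPhase m (-f) f = 1 := by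
    have h := causalProp_add_left hm (-f) f f
    have h2 := causalProp_swap m f f
    rw [neg_add_cancel, causalProp_zero_left hm] at h
    rw [weylPhase, show causalProp m (-f) f = 0 by linarith]
    simp
  rw [this, one_smul]

end WeylAlgebra

/-! The GNS construction for the vacuum. -/

set_option linter.unusedVariables false in
/-- The Weyl algebra with the (semi-)inner product `⟪a, b⟫ = ω(a* b)`. -/
def PreGNS (d : ℕ) {m : ℝ} (hm : 0 < m) : Type := WeylAlgebra d hm

namespace PreGNS
open WeylAlgebra UniformSpace UniformSpace.Completion

variable {d : ℕ} {m : ℝ} {hm : 0 < m}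

instance : AddCommGroup (PreGNS d hm) := inferInstanceAs (AddCommGroup (WeylAlgebra d hm))
instance : Module ℂ (PreGNS d hm) := inferInstanceAs (Module ℂ (WeylAlgebra d hm))

/-- The identity map. -/
def of (d : ℕ) (hm : 0 < m) : WeylAlgebra d hm ≃ₗ[ℂ] PreGNS d hm := LinearEquiv.refl ℂ _

/-- The inner product `⟪a, b⟫ = ω(a* b)`. -/
abbrev core (d : ℕ) (hm : 0 < m) : PreInnerProductSpace.Core ℂ (PreGNS d hm) where
  inner a b := vacuumState d hm (star ((of d hm).symm a) * (of d hm).symm b)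
  conj_inner_symm a b := state_star _ _
  re_inner_nonneg a := (Complex.le_def.1 (state_star_mul_self_nonneg _)).1
  add_left a b c := by simp [add_mul]
  smul_left a b r := by simp [star_smul]

instance : SeminormedAddCommGroup (PreGNS d hm) :=
  InnerProductSpace.Core.toSeminormedAddCommGroup (c := core d hm)
instance : InnerProductSpace ℂ (PreGNS d hm) := InnerProductSpace.ofCore (core d hm)

lemma inner_def (a b : WeylAlgebra d hm) :
    ⟪of d hm a, of d hm b⟫_ℂ = vacuumState d hm (star a * b) := rfl

/-- Left multiplication. -/
def leftMulLin (d : ℕ) (hm : 0 < m) : WeylAlgebra d hm →ₗ[ℂ] PreGNS d hm →ₗ[ℂ] PreGNS d hm where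
  toFun a := (of d hm).toLinearMap ∘ₗ LinearMap.mulLeft ℂ a ∘ₗ (of d hm).symm.toLinearMap
  map_add' a b := by ext x; simp [add_mul]
  map_smul' c a := by ext x; simp

lemma leftMulLin_apply (a b : WeylAlgebra d hm) :
    leftMulLin d hm a (of d hm b) = of d hm (a * b) := rfl

lemma norm_leftMul_W (f : TestFn d) (x : PreGNS d hm) : ‖leftMulLin d hm (W hm f) x‖ = ‖x‖ := by
  obtain ⟨b, rfl⟩ := (of d hm).surjective x
  rw [leftMulLin_apply, @norm_eq_sqrt_re_inner ℂ, @norm_eq_sqrt_re_inner ℂ, inner_def, inner_def,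
    star_mul, mul_assoc, ← mul_assoc (star (W hm f)), star_W_mul_W_self, one_mul]

lemma exists_bound (a : WeylAlgebra d hm) : ∃ C : ℝ, ∀ x, ‖leftMulLin d hm a x‖ ≤ C * ‖x‖ := by
  induction a using induction_W with
  | hz => exact ⟨0, fun x => by simp⟩
  | ha a b h h' =>
    obtain ⟨C, hC⟩ := h
    obtain ⟨D, hD⟩ := h'
    refine ⟨C + D, fun x => ?_⟩
    rw [map_add, LinearMap.add_apply, add_mul]
    exact (norm_add_le _ _).trans (add_le_add (hC x) (hD x))
  | hW c f =>
    refine ⟨‖c‖, fun x => ?_⟩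
    rw [map_smul, LinearMap.smul_apply, norm_smul, norm_leftMul_W]

/-- Left multiplication as a bounded operator. -/
def leftMul (a : WeylAlgebra d hm) : PreGNS d hm →L[ℂ] PreGNS d hm :=
  LinearMap.mkContinuousOfExistsBound (leftMulLin d hm a) (exists_bound a)

lemma leftMul_apply (a b : WeylAlgebra d hm) : leftMul a (of d hm b) = of d hm (a * b) := rfl

/-- The GNS representation on the completion. -/
def rep (d : ℕ) (hm : 0 < m) :
    WeylAlgebra d hm →⋆ₐ[ℂ] (Completion (PreGNS d hm) →L[ℂ] Completion (PreGNS d hm)) where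
  toFun a := (leftMul a).completion
  map_one' := by
    ext x
    induction x using induction_on with
    | hp => apply isClosed_eq <;> fun_prop
    | ih x => obtain ⟨b, rfl⟩ := (of d hm).surjective x; simp [leftMul_apply]
  map_zero' := by
    ext x
    induction x using induction_on with
    | hp => apply isClosed_eq <;> fun_prop
    | ih x =>
      obtain ⟨b, rfl⟩ := (of d hm).surjective x
      simp [leftMul_apply, Completion.coe_zero]
  map_add' a a' := by
    ext x
    induction x using induction_on with
    | hp => apply isClosed_eq <;> fun_prop
    | ih x =>
      obtain ⟨b, rfl⟩ := (of d hm).surjective x; simp [leftMul_apply, add_mul, Completion.coe_add]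
  map_mul' a a' := by
    ext x
    induction x using induction_on with
    | hp => apply isClosed_eq <;> fun_prop
    | ih x => obtain ⟨b, rfl⟩ := (of d hm).surjective x; simp [leftMul_apply, mul_assoc]
  commutes' r := by
    ext x
    induction x using induction_on with
    | hp => apply isClosed_eq <;> fun_prop
    | ih x =>
      obtain ⟨b, rfl⟩ := (of d hm).surjective x
      simp [leftMul_apply, Algebra.algebraMap_eq_smul_one, Completion.coe_smul]
  map_star' a := by
    refine (ContinuousLinearMap.eq_adjoint_iff _ _).mpr fun x y => ?_
    induction x, y using induction_on₂ with
    | hp => apply isClosed_eq <;> fun_prop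
    | ih x y =>
      obtain ⟨b, rfl⟩ := (of d hm).surjective x
      obtain ⟨c, rfl⟩ := (of d hm).surjective y
      simp [leftMul_apply, inner_def, mul_assoc]

end PreGNS

/-- The GNS construction gives a GNS triple of the vacuum. -/
def vacuumGNS (d : ℕ) {m : ℝ} (hm : 0 < m) :
    GNSTriple (vacuumState d hm) (UniformSpace.Completion (PreGNS d hm)) where
  rep := PreGNS.rep d hm
  vac := (PreGNS.of d hm 1 : PreGNS d hm)
  inner_rep a := by
    simp [PreGNS.rep, PreGNS.leftMul_apply, PreGNS.inner_def]
  cyclic := by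
    have : (Set.range fun a => PreGNS.rep d hm a (PreGNS.of d hm 1 : PreGNS d hm))
        = Set.range (fun x : PreGNS d hm => (x : UniformSpace.Completion (PreGNS d hm))) := by
      rw [← (PreGNS.of d hm).surjective.range_comp]
      congr 1
      funext a
      simp [PreGNS.rep, PreGNS.leftMul_apply]
    rw [this]
    exact UniformSpace.Completion.denseRange_coe

/-! ### Functionals of the field configuration -/

/-- Field configurations. All functionals below are given by formulas that are entire in the
configuration, so that they are considered on complex-valued configurations as well. -/
abbrev Config (d : ℕ) := Minkowski d → ℂ

/-- Functionals of the field configuration. -/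
abbrev Functional (d : ℕ) := Config d → ℂ

/-- `(Δ₊ h)(x) = ∫ Δ₊(x - y) h(y) dy`. -/
def deltaRight {d : ℕ} (m : ℝ) (h : TestFn d) : Config d := fun x =>
  ∫ p : Space d, modeWeight d m p * (cexp (I * phaseArg m p x) * shell m h p)

/-- `(h Δ₊)(y) = ∫ h(x) Δ₊(x - y) dx`. -/
def deltaLeft {d : ℕ} (m : ℝ) (h : TestFn d) : Config d := fun y =>
  ∫ p : Space d, modeWeight d m p * (conj (shell m h p) * cexp (-I * phaseArg m p y))

/-- The linear field `Φ(h)`. -/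
def field {d : ℕ} (h : TestFn d) : Functional d := fun φ => ∫ x : Minkowski d, h x * φ x

/-- The Weyl generator `W₊(h) = e^{iΦ(h)} e^{-Δ₊(h, h)/2}` as a functional. -/
def weylFunctional {d : ℕ} (m : ℝ) (h : TestFn d) : Functional d := fun φ =>
  cexp (I * field h φ) * cexp (-(1 / 2) * twoPoint m h h)

/-- The product `F ⋆ W₊(h)` where
`F ⋆ G = ℳ exp(∫ Δ₊(x, y) δ/δφ(x) ⊗ δ/δφ(y) dx dy) (F ⊗ G)`. Every derivative of the exponential
`W₊(h)` contributes a factor `i h(y)`, so that the exponential series is the Taylor series of `F`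
about `φ` with increment `i Δ₊ h`. -/
def starWeylRight {d : ℕ} (m : ℝ) (F : Functional d) (h : TestFn d) : Functional d := fun φ =>
  F (φ + I • deltaRight m h) * weylFunctional m h φ

/-- The product `W₊(h) ⋆ F`, likewise. -/
def starWeylLeft {d : ℕ} (m : ℝ) (h : TestFn d) (F : Functional d) : Functional d := fun φ =>
  weylFunctional m h φ * F (φ + I • deltaLeft m h)

/-- `A` is the operator `π(F)` that represents the functional `F` in the GNS representation: its
matrix elements between the coherent vectors `π(W(h)) Ψ` are
`⟪π(W(k)) Ψ, A π(W(h)) Ψ⟫ = ω(W₊(k)* ⋆ F ⋆ W₊(h))`, and the vacuum `ω` is the evaluation of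
functionals on the vanishing configuration. -/
def Represents {d : ℕ} {m : ℝ} {hm : 0 < m} {H : Type*} [NormedAddCommGroup H]
    [InnerProductSpace ℂ H] [CompleteSpace H] (T : GNSTriple (vacuumState d hm) H)
    (F : Functional d) (A : H →L[ℂ] H) : Prop :=
  ∀ h k : TestFn d,
    ⟪T.rep (WeylAlgebra.W hm k) T.vac, A (T.rep (WeylAlgebra.W hm h) T.vac)⟫_ℂ
      = starWeylLeft m (-k) (starWeylRight m F h) 0

/-! ### The regularization and the S-matrix -/

/-- Cutoff functions: smooth, compactly supported, nonnegative, symmetric, of integral one. -/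
structure IsCutoff {d : ℕ} (χ : Space d → ℝ) : Prop where
  contDiff : ContDiff ℝ ∞ χ
  hasCompactSupport : HasCompactSupport χ
  nonneg : ∀ x, 0 ≤ χ x
  symmetric : ∀ x, χ (-x) = χ x
  integral_eq_one : ∫ x, χ x = 1

/-- The Fourier transform `χ̂(𝐩) = ∫ e^{-i𝐩·𝐱} χ(𝐱) d𝐱`. -/
def chiHat {d : ℕ} (χ : Space d → ℝ) (p : Space d) : ℂ :=
  ∫ x : Space d, cexp (-I * ⟪p, x⟫_ℝ) * χ x

/-- The regularized two-point function
`Δ_{+,Λ}(t, 𝐱) = (2π)^{-(d-1)} ∫ (2ω_𝐩)⁻¹ e^{i𝐩·𝐱 - iω_𝐩 t} χ̂(Λ𝐩)² d𝐩`. -/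
def regTwoPoint {d : ℕ} (m : ℝ) (χ : Space d → ℝ) (Λ : ℝ) (x : Minkowski d) : ℂ :=
  ∫ p : Space d, modeWeight d m p * (cexp (I * phaseArg m p x) * chiHat χ (Λ • p) ^ 2)

/-- The regularized Feynman propagator
`Δ_{F,Λ}(t, 𝐱) = θ(t) Δ_{+,Λ}(t, 𝐱) + θ(-t) Δ_{+,Λ}(-t, 𝐱)`. -/
def regFeynman {d : ℕ} (m : ℝ) (χ : Space d → ℝ) (Λ : ℝ) (x : Minkowski d) : ℂ :=
  if 0 ≤ x.1 then regTwoPoint m χ Λ x else regTwoPoint m χ Λ (-x.1, x.2)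

/-- `ι_Λ φ = G_Λ * φ` with `G_Λ(t, 𝐱) = δ(t) Λ^{-(d-1)} χ(𝐱/Λ)`, whose spatial Fourier transform is
`χ̂(Λ𝐩)`. -/
def iotaMap {d : ℕ} (χ : Space d → ℝ) (Λ : ℝ) (φ : Config d) : Config d := fun x =>
  ∫ y : Space d, ((Λ ^ (d - 1))⁻¹ * χ (Λ⁻¹ • y) : ℝ) * φ (x.1, x.2 - y)

/-- The pullback `r_Λ F = F ∘ ι_Λ`. -/
def pullback {d : ℕ} (χ : Space d → ℝ) (Λ : ℝ) (F : Functional d) : Functional d := fun φ =>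
  F (iotaMap χ Λ φ)

/-- The regularized time-ordered product of the vertex operators
`V_{a_i}(g_i) = ∫ e^{i a_i φ(x)} g_i(x) dx`, namely
`∫_{M^n} ∏ e^{i a_i φ(x_i)} g_i(x_i) exp(-∑_{l<j} a_l a_j Δ_{F,Λ}(x_l - x_j)) dx`. -/
def timeOrderedVertex {d : ℕ} (m : ℝ) (χ : Space d → ℝ) (Λ : ℝ) {n : ℕ} (a : Fin n → ℝ)
    (g : Fin n → TestFn d) : Functional d := fun φ =>
  ∫ x : Fin n → Minkowski d, (∏ i, cexp (I * a i * φ (x i)) * g i (x i)) *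
    cexp (-∑ j, ∑ l ∈ Finset.Iio j, a l * a j * regFeynman m χ Λ (x l - x j))

/-- The term of order `n` of the S-matrix `S_Λ(L_I(f, g))`, the time-ordered exponential of
`L_I(f, g) = ∫ f(a) V_a(g) da`, namely `(i^n/n!) L_I ·_T ⋯ ·_T L_I`, which is
`(i^n/n!) ∫_{ℝ^n} ∏ f(a_i) (V_{a_1}(g) ·_T ⋯ ·_T V_{a_n}(g)) da`. -/
def sMatrixTerm {d : ℕ} (m : ℝ) (χ : Space d → ℝ) (Λ : ℝ) (f : ℝ → ℂ) (g : TestFn d) (n : ℕ) :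
    Functional d := fun φ =>
  I ^ n / (n.factorial : ℂ) *
    ∫ a : Fin n → ℝ, (∏ i, f (a i)) * timeOrderedVertex m χ Λ a (fun _ => g) φ

end ScalarQFT

end

open ScalarQFT

/-!
# Unitarity of the regularized S-matrix in the vacuum representation

In the vacuum representation the field satisfies the Weyl relations over the one-particle space
`L²(ℝ^(d-1))`, and the coherent vectors `π(W(h)) Ψ` have the inner products of exponential vectors.
Because of these explicit inner products the Weyl operators depend strongly continuously on the
one-particle vector, so that they extend to the closure of the real space of test functions
(`WeylSystem.extend`). The regularized field at a spacetime point belongs to this closure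
(`pointVec_mem`): regularization in space makes its one-particle vector square integrable, and the
restriction to a sharp time is a limit of smearings in time. Hence `e^{iaφ_Λ(x)}` is a multiple
`e^{a² Δ_{+,Λ}(0) / 2}` of a unitary Weyl operator.

The Feynman propagator agrees with the inner product of the one-particle vectors of two points in
time order; its real part does not depend on the order. The real part in the exponent of the
time-ordered product therefore combines with the norm of the total one-particle vector to the
factors `e^{a_j² Δ_{+,Λ}(0) / 2}`, and what is left is a Weyl operator times a phase, the imaginary
part of the Feynman propagator. So the term of order `n` is an integral of multiples of unitaries
(`represents_expTerm`), bounded by `Cⁿ / n!` for `C = ‖f e^{a² Δ_{+,Λ}(0) / 2}‖₁ ‖g‖₁`, and the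
series converges in norm. A bounded operator is determined by its matrix elements between coherent
vectors, which gives uniqueness.

By hermiticity of the interaction, the adjoint of the ordered product is the product in reverse
order, whose phase is opposite (`Vertex.adjoint_ordered`). The term of order `n` in `S* S` is thus,
up to a factor, the integral of the alternating sum, over all subsets of `n` vertices, of the
product of the vertices in the subset in reverse order and of the others in order. The latest vertex
is the last factor of the reversed product or the first factor of the ordered one; moving it from one to
the other does not change the product but changes the sign, so that the sum vanishes
(`sum_orderPhase_eq_zero`). For `S S*` the earliest vertex plays the same role.
-/

noncomputable section

set_option linter.unusedSectionVars false

namespace ScalarQFT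

open Complex Filter Topology
open scoped FourierTransform

/-! ### Weyl systems and their strongly continuous extension -/

/-- Operators of norm at most `2` that converge to `0` on a total set converge to `0` strongly. -/
lemma tendsto_zero_of_total {X H : Type*} [NormedAddCommGroup H] [NormedSpace ℂ H]
    {l : Filter X} (D : X → H →L[ℂ] H) (hD : ∀ x ξ, ‖D x ξ‖ ≤ 2 * ‖ξ‖) {s : Set H}
    (hs : Dense (Submodule.span ℂ s : Set H))
    (h0 : ∀ ξ ∈ s, Tendsto (fun x => D x ξ) l (𝓝 0)) (ξ : H) :
    Tendsto (fun x => D x ξ) l (𝓝 0) := by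
  have hspan : ∀ η ∈ Submodule.span ℂ s, Tendsto (fun x => D x η) l (𝓝 0) := by
    intro η hη
    induction hη using Submodule.span_induction with
    | mem x hx => exact h0 x hx
    | zero => simpa using tendsto_const_nhds
    | add x y _ _ hx hy => simpa using hx.add hy
    | smul c x _ hx => simpa using hx.const_smul c
  rw [Metric.tendsto_nhds]
  intro ε hε
  obtain ⟨η, hη, hd⟩ := Metric.mem_closure_iff.1 (hs ξ) (ε / 4) (by positivity)
  filter_upwards [Metric.tendsto_nhds.1 (hspan η hη) (ε / 2) (by positivity)] with x hx
  rw [dist_zero_right] at hx ⊢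
  have h1 : D x ξ = D x (ξ - η) + D x η := by simp
  have h2 := hD x (ξ - η)
  rw [dist_eq_norm] at hd
  rw [h1]
  linarith [norm_add_le (D x (ξ - η)) (D x η)]

/-- A cyclic Weyl system over an additive group `T`, whose two-point function is pulled back from
the inner product of the one-particle space `K` along `j : T →+ K`: unitaries `op f` that obey the
Weyl relations for the symplectic form `Im ⟪j f, j g⟫`, and a cyclic vector on which the state is
the Fock vacuum. -/
structure WeylSystem {T K : Type*} [AddCommGroup T] [NormedAddCommGroup K] [InnerProductSpace ℂ K]
    (j : T →+ K) (H : Type*) [NormedAddCommGroup H] [InnerProductSpace ℂ H] where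
  op : T → H →L[ℂ] H
  op_op : ∀ f g ξ, op f (op g ξ) = cexp (-I * (⟪j f, j g⟫_ℂ).im) • op (f + g) ξ
  op_zero : ∀ ξ, op 0 ξ = ξ
  inner_op_left : ∀ f ξ η, ⟪op f ξ, η⟫_ℂ = ⟪ξ, op (-f) η⟫_ℂ
  vac : H
  inner_vac : ∀ f, ⟪vac, op f vac⟫_ℂ = cexp (-(1 / 2) * ⟪j f, j f⟫_ℂ)
  total : Dense (Submodule.span ℂ (Set.range fun f => op f vac) : Set H)

namespace WeylSystem

section ClosedRange

variable {T K : Type*} [AddCommGroup T] [NormedAddCommGroup K] {j : T →+ K}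

/-- The closure of the group of one-particle vectors, over which the Weyl system extends. -/
abbrev closedRange (j : T →+ K) : AddSubgroup K := j.range.topologicalClosure

/-- The filter of elements of `T` whose one-particle vectors converge to `v`. -/
def approx (j : T →+ K) (v : closedRange j) : Filter T := comap j (𝓝 (v : K))

instance (v : closedRange j) : (approx j v).NeBot := by
  have h : (v : K) ∈ closure (Set.range j) := v.2
  refine comap_neBot_iff.2 fun t ht => ?_
  obtain ⟨_, hx, f, rfl⟩ := mem_closure_iff_nhds.1 h t ht
  exact ⟨f, hx⟩

lemma tendsto_approx (v : closedRange j) : Tendsto j (approx j v) (𝓝 (v : K)) := tendsto_comap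

lemma mem_closedRange (j : T →+ K) (f : T) : j f ∈ closedRange j :=
  AddSubgroup.le_topologicalClosure _ ⟨f, rfl⟩

end ClosedRange

variable {T K H : Type*} [AddCommGroup T] [NormedAddCommGroup K] [InnerProductSpace ℂ K]
  {j : T →+ K} [NormedAddCommGroup H] [InnerProductSpace ℂ H] (w : WeylSystem j H)

lemma im_inner_self (x : K) : (⟪x, x⟫_ℂ).im = 0 := inner_self_im (𝕜 := ℂ) x

lemma op_neg_op (f : T) (ξ : H) : w.op (-f) (w.op f ξ) = ξ := by
  rw [w.op_op, neg_add_cancel, w.op_zero, map_neg, inner_neg_left, Complex.neg_im, im_inner_self]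
  simp

lemma norm_op (f : T) (ξ : H) : ‖w.op f ξ‖ = ‖ξ‖ := by
  rw [@norm_eq_sqrt_re_inner ℂ, @norm_eq_sqrt_re_inner ℂ, w.inner_op_left, op_neg_op]

/-- Matrix elements between coherent vectors. -/
lemma inner_op_vac_op_vac (f g : T) :
    ⟪w.op f w.vac, w.op g w.vac⟫_ℂ
      = cexp (-(1 / 2) * ⟪j f, j f⟫_ℂ - (1 / 2) * ⟪j g, j g⟫_ℂ + ⟪j f, j g⟫_ℂ) := by
  rw [w.inner_op_left, w.op_op, inner_smul_right, w.inner_vac, ← Complex.exp_add]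
  congr 1
  have h1 : (((⟪j f, j g⟫_ℂ).im : ℝ) : ℂ) * I = (⟪j f, j g⟫_ℂ - ⟪j g, j f⟫_ℂ) / 2 := by
    rw [← inner_conj_symm (j g) (j f), Complex.sub_conj]
    push_cast
    ring
  simp only [map_add, map_neg, inner_add_left, inner_add_right, inner_neg_left, inner_neg_right,
    Complex.neg_im, Complex.ofReal_neg]
  linear_combination h1

lemma inner_op_op_vac (f g k : T) :
    ⟪w.op f (w.op k w.vac), w.op g (w.op k w.vac)⟫_ℂ
      = cexp (I * (⟪j f, j k⟫_ℂ).im - I * (⟪j g, j k⟫_ℂ).im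
        - (1 / 2) * ⟪j f + j k, j f + j k⟫_ℂ - (1 / 2) * ⟪j g + j k, j g + j k⟫_ℂ
        + ⟪j f + j k, j g + j k⟫_ℂ) := by
  rw [w.op_op, w.op_op, inner_smul_left, inner_smul_right, inner_op_vac_op_vac, ← Complex.exp_conj,
    ← Complex.exp_add, ← Complex.exp_add]
  congr 1
  simp only [map_mul, map_neg, Complex.conj_I, Complex.conj_ofReal, map_add]
  ring

/-- The Weyl operators depend strongly continuously on the one-particle vector: on coherent vectors
this follows from their explicit inner products, and coherent vectors are total. -/
lemma tendsto_op_sub_op {X : Type*} {l : Filter X} {f g : X → T} {v : K}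
    (hf : Tendsto (fun x => j (f x)) l (𝓝 v)) (hg : Tendsto (fun x => j (g x)) l (𝓝 v)) (ξ : H) :
    Tendsto (fun x => w.op (f x) ξ - w.op (g x) ξ) l (𝓝 0) := by
  refine tendsto_zero_of_total (fun x => w.op (f x) - w.op (g x)) (fun x ξ => ?_) w.total ?_ ξ
  · have := norm_sub_le (w.op (f x) ξ) (w.op (g x) ξ)
    rw [w.norm_op, w.norm_op] at this
    simp only [sub_apply]
    linarith
  rintro _ ⟨k, rfl⟩
  simp only [sub_apply]
  have hexp : Tendsto (fun x => ⟪w.op (f x) (w.op k w.vac), w.op (g x) (w.op k w.vac)⟫_ℂ) l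
      (𝓝 1) := by
    simp only [w.inner_op_op_vac]
    have hc : Continuous fun p : K × K => cexp (I * (⟪p.1, j k⟫_ℂ).im - I * (⟪p.2, j k⟫_ℂ).im
        - (1 / 2) * ⟪p.1 + j k, p.1 + j k⟫_ℂ - (1 / 2) * ⟪p.2 + j k, p.2 + j k⟫_ℂ
        + ⟪p.1 + j k, p.2 + j k⟫_ℂ) := by fun_prop
    have := (hc.tendsto (v, v)).comp (hf.prodMk_nhds hg)
    convert! this using 2
    symm
    simp only
    refine (congrArg cexp ?_).trans Complex.exp_zero
    ring
  have hvac : ‖w.vac‖ ^ 2 = 1 := by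
    have := w.inner_vac 0
    rw [w.op_zero, map_zero, inner_zero_left, mul_zero, Complex.exp_zero,
      inner_self_eq_norm_sq_to_K] at this
    exact Complex.ofReal_injective (by simpa using this)
  have hsq : Tendsto (fun x => ‖w.op (f x) (w.op k w.vac) - w.op (g x) (w.op k w.vac)‖ ^ 2) l
      (𝓝 0) := by
    have h1 : ∀ x, ‖w.op (f x) (w.op k w.vac) - w.op (g x) (w.op k w.vac)‖ ^ 2
        = 2 - 2 * (⟪w.op (f x) (w.op k w.vac), w.op (g x) (w.op k w.vac)⟫_ℂ).re := by
      intro x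
      rw [@norm_sub_sq ℂ, w.norm_op (f x), w.norm_op (g x), w.norm_op k, hvac]
      simp only [RCLike.re_to_complex]
      ring
    simp only [h1]
    have := ((Complex.continuous_re.tendsto 1).comp hexp).const_mul 2 |>.const_sub 2
    simpa using this
  have := hsq.sqrt
  simp only [Real.sqrt_zero, Real.sqrt_sq (norm_nonneg _)] at this
  exact tendsto_zero_iff_norm_tendsto_zero.2 this

/-- An operator is determined by its matrix elements between coherent vectors. -/
lemma ext_of_matrix_elements {A B : H →L[ℂ] H}
    (h : ∀ f g, ⟪w.op g w.vac, A (w.op f w.vac)⟫_ℂ = ⟪w.op g w.vac, B (w.op f w.vac)⟫_ℂ) :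
    A = B := by
  refine ContinuousLinearMap.ext_on w.total ?_
  rintro _ ⟨f, rfl⟩
  refine w.total.eq_of_inner_left (𝕜 := ℂ) fun η hη => ?_
  induction hη using Submodule.span_induction with
  | mem x hx =>
    obtain ⟨g, rfl⟩ := hx
    rw [← inner_conj_symm, h, inner_conj_symm]
  | zero => simp
  | add x y _ _ hx hy => simp only [inner_add_right, hx, hy]
  | smul c x _ hx => simp only [inner_smul_right, hx]

variable [CompleteSpace H]

lemma exists_tendsto_op (v : closedRange j) (ξ : H) :
    ∃ η, Tendsto (fun f => w.op f ξ) (approx j v) (𝓝 η) := by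
  refine cauchy_map_iff_exists_tendsto.1 (cauchy_map_iff.2 ⟨inferInstance, ?_⟩)
  rw [Metric.uniformity_eq_comap_nhds_zero, tendsto_comap_iff]
  have := w.tendsto_op_sub_op ((tendsto_approx v).comp tendsto_fst)
    ((tendsto_approx v).comp tendsto_snd) ξ
  have := this.norm
  simpa [dist_eq_norm, Function.comp_def] using this

/-- The Weyl operator of a limit of one-particle vectors, as a strong limit. -/
def extendOp (v : closedRange j) : H →L[ℂ] H :=
  LinearMap.mkContinuous
    (linearMapOfTendsto (l := approx j v) (fun ξ => (w.exists_tendsto_op v ξ).choose)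
      (fun f => (w.op f : H →ₗ[ℂ] H))
      (tendsto_pi_nhds.2 fun ξ => (w.exists_tendsto_op v ξ).choose_spec)) 1 fun ξ => by
    rw [one_mul]
    refine le_of_tendsto ((w.exists_tendsto_op v ξ).choose_spec.norm) (.of_forall fun f => ?_)
    rw [w.norm_op]

lemma tendsto_extendOp (v : closedRange j) (ξ : H) :
    Tendsto (fun f => w.op f ξ) (approx j v) (𝓝 (w.extendOp v ξ)) :=
  (w.exists_tendsto_op v ξ).choose_spec

lemma tendsto_op_of_tendsto {X : Type*} {l : Filter X} {f : X → T} (v : closedRange j)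
    (hf : Tendsto (fun x => j (f x)) l (𝓝 (v : K))) (ξ : H) :
    Tendsto (fun x => w.op (f x) ξ) l (𝓝 (w.extendOp v ξ)) :=
  (w.tendsto_extendOp v ξ).comp (tendsto_comap_iff.2 hf)

lemma extendOp_apply (f : T) : w.extendOp ⟨j f, mem_closedRange j f⟩ = w.op f := by
  ext ξ
  have h := w.tendsto_op_of_tendsto (l := (⊤ : Filter Unit)) (f := fun _ => f)
    ⟨j f, mem_closedRange j f⟩ tendsto_const_nhds ξ
  exact tendsto_nhds_unique h tendsto_const_nhds

lemma extendOp_extendOp (u v : closedRange j) (ξ : H) :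
    w.extendOp u (w.extendOp v ξ)
      = cexp (-I * (⟪(u : K), (v : K)⟫_ℂ).im) • w.extendOp (u + v) ξ := by
  have hu : Tendsto (fun p : T × T => j p.1) (approx j u ×ˢ approx j v) (𝓝 (u : K)) :=
    (tendsto_approx u).comp tendsto_fst
  have hv : Tendsto (fun p : T × T => j p.2) (approx j u ×ˢ approx j v) (𝓝 (v : K)) :=
    (tendsto_approx v).comp tendsto_snd
  have h1 : Tendsto (fun p : T × T => w.op p.1 (w.op p.2 ξ)) (approx j u ×ˢ approx j v)
      (𝓝 (w.extendOp u (w.extendOp v ξ))) := by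
    have ha := w.tendsto_op_of_tendsto u hu (w.extendOp v ξ)
    have hb := ((w.tendsto_op_of_tendsto v hv ξ).sub_const (w.extendOp v ξ)).norm
    simp only [sub_self, norm_zero] at hb
    have hc : Tendsto (fun p : T × T => w.op p.1 (w.op p.2 ξ - w.extendOp v ξ))
        (approx j u ×ˢ approx j v) (𝓝 0) := by
      rw [tendsto_zero_iff_norm_tendsto_zero]
      simpa only [w.norm_op] using hb
    simpa using hc.add ha
  have h2 : Tendsto (fun p : T × T => cexp (-I * (⟪j p.1, j p.2⟫_ℂ).im) • w.op (p.1 + p.2) ξ)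
      (approx j u ×ˢ approx j v)
      (𝓝 (cexp (-I * (⟪(u : K), (v : K)⟫_ℂ).im) • w.extendOp (u + v) ξ)) := by
    refine Tendsto.smul ?_ (w.tendsto_op_of_tendsto (u + v) ?_ ξ)
    · have hc : Continuous fun p : K × K => cexp (-I * (⟪p.1, p.2⟫_ℂ).im) := by fun_prop
      have := (hc.tendsto ((u : K), (v : K))).comp (hu.prodMk_nhds hv)
      simpa only [Function.comp_def] using this
    · simpa using hu.add hv
  simp only [w.op_op] at h1
  exact tendsto_nhds_unique h1 h2

/-- The Weyl system over the closure of the one-particle vectors. -/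
def extend : WeylSystem (closedRange j).subtype H where
  op := w.extendOp
  op_op := w.extendOp_extendOp
  op_zero ξ := by
    have h := w.tendsto_op_of_tendsto (l := (⊤ : Filter Unit)) (f := fun _ => 0)
      (0 : closedRange j) (by simp) ξ
    simp only [w.op_zero] at h
    exact tendsto_nhds_unique h tendsto_const_nhds
  inner_op_left v ξ η := by
    have h1 := (w.tendsto_extendOp v ξ).inner (𝕜 := ℂ) (tendsto_const_nhds (x := η))
    have h2 := (tendsto_const_nhds (x := ξ)).inner (𝕜 := ℂ)
      (w.tendsto_op_of_tendsto (-v) (f := fun f => -f)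
        (by simpa using (tendsto_approx v).neg) η)
    simp only [w.inner_op_left] at h1
    exact tendsto_nhds_unique h1 h2
  vac := w.vac
  inner_vac v := by
    have h1 := (tendsto_const_nhds (x := w.vac)).inner (𝕜 := ℂ) (w.tendsto_extendOp v w.vac)
    simp only [w.inner_vac] at h1
    have hc : Continuous fun p : K => cexp (-(1 / 2) * ⟪p, p⟫_ℂ) := by fun_prop
    exact tendsto_nhds_unique h1 ((hc.tendsto _).comp (tendsto_approx v))
  total := by
    refine w.total.mono (Submodule.span_mono ?_)
    rintro _ ⟨f, rfl⟩
    exact ⟨⟨j f, mem_closedRange j f⟩, by simp only [extendOp_apply]⟩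

lemma extend_op (f : T) : w.extend.op ⟨j f, mem_closedRange j f⟩ = w.op f := w.extendOp_apply f

end WeylSystem

/-- Over a subgroup of the one-particle space, the Weyl operators are strongly continuous. -/
lemma WeylSystem.continuous_op {K H : Type*} [NormedAddCommGroup K] [InnerProductSpace ℂ K]
    [NormedAddCommGroup H] [InnerProductSpace ℂ H] {V : AddSubgroup K}
    (w : WeylSystem V.subtype H) (ξ : H) : Continuous fun v : V => w.op v ξ := by
  rw [continuous_iff_continuousAt]
  intro v
  have h := w.tendsto_op_sub_op (l := 𝓝 v) (f := id) (g := fun _ => v) (v := (v : K))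
    (continuous_subtype_val.tendsto v) tendsto_const_nhds ξ
  have := h.add_const (w.op v ξ)
  simpa [ContinuousAt] using this

/-! ### Smeared Weyl operators -/

namespace WeylSystem

variable {K H : Type*} [NormedAddCommGroup K] [InnerProductSpace ℂ K]
  [NormedAddCommGroup H] [InnerProductSpace ℂ H] {V : AddSubgroup K}
  (w : WeylSystem V.subtype H)
  {X Y : Type*} [TopologicalSpace X] [SecondCountableTopology X] [MeasureSpace X]
  [OpensMeasurableSpace X]
  [TopologicalSpace Y] [SecondCountableTopology Y] [MeasureSpace Y] [OpensMeasurableSpace Y]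

lemma integrable_smul_op {c : X → ℂ} (hc : Integrable c) {U : X → V} (hU : Continuous U) (ξ : H) :
    Integrable fun x => c x • w.op (U x) ξ := by
  refine (hc.norm.mul_const ‖ξ‖).mono' ?_ (.of_forall fun x => ?_)
  · exact hc.aestronglyMeasurable.smul ((w.continuous_op ξ).comp hU).aestronglyMeasurable
  · rw [norm_smul, w.norm_op]

/-- The operator `∫ c(x) W(U(x)) dx`, as a strong integral. -/
def smear {c : X → ℂ} (hc : Integrable c) {U : X → V} (hU : Continuous U) : H →L[ℂ] H :=
  LinearMap.mkContinuous
    { toFun := fun ξ => ∫ x, c x • w.op (U x) ξ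
      map_add' := fun ξ η => by
        rw [← integral_add (w.integrable_smul_op hc hU ξ) (w.integrable_smul_op hc hU η)]
        simp
      map_smul' := fun a ξ => by
        rw [RingHom.id_apply, ← integral_smul]
        simp only [map_smul, smul_comm a] } (∫ x, ‖c x‖) fun ξ => by
    refine (norm_integral_le_integral_norm _).trans_eq ?_
    rw [← integral_mul_const]
    simp only [norm_smul, w.norm_op]

lemma smear_apply {c : X → ℂ} (hc : Integrable c) {U : X → V} (hU : Continuous U) (ξ : H) :
    w.smear hc hU ξ = ∫ x, c x • w.op (U x) ξ := rfl

lemma norm_smear_le {c : X → ℂ} (hc : Integrable c) {U : X → V} (hU : Continuous U) :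
    ‖w.smear hc hU‖ ≤ ∫ x, ‖c x‖ :=
  LinearMap.mkContinuous_norm_le _ (integral_nonneg fun _ => norm_nonneg _) _

variable [CompleteSpace H]

lemma inner_smear_left {c : X → ℂ} (hc : Integrable c) {U : X → V} (hU : Continuous U) (ξ η : H) :
    ⟪w.smear hc hU ξ, η⟫_ℂ = ⟪ξ, ∫ x, conj (c x) • w.op (-U x) η⟫_ℂ := by
  have hc' : Integrable fun x => conj (c x) :=
    hc.norm.mono' (Complex.continuous_conj.comp_aestronglyMeasurable hc.aestronglyMeasurable)
      (.of_forall fun x => by simp)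
  have hi := w.integrable_smul_op hc' (U := fun x => -U x) hU.neg η
  rw [smear_apply, ← inner_conj_symm, ← integral_inner (w.integrable_smul_op hc hU ξ) η,
    ← integral_inner hi ξ, ← integral_conj]
  refine integral_congr_ae (.of_forall fun x => ?_)
  change conj ⟪η, c x • w.op (U x) ξ⟫_ℂ = ⟪ξ, conj (c x) • w.op (-U x) η⟫_ℂ
  rw [inner_conj_symm, inner_smul_left, inner_smul_right, w.inner_op_left]

variable [SFinite (volume : Measure X)] [SFinite (volume : Measure Y)]

lemma integrable_mul_phase {c : X → ℂ} (hc : Integrable c) {U : X → V} (hU : Continuous U)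
    {c' : Y → ℂ} (hc' : Integrable c') {U' : Y → V} (hU' : Continuous U') :
    Integrable fun p : X × Y =>
      c p.1 * c' p.2 * cexp (-I * (⟪(U p.1 : K), (U' p.2 : K)⟫_ℂ).im) := by
  refine (hc.mul_prod hc').mul_bdd (c := 1) (Continuous.aestronglyMeasurable ?_)
    (.of_forall fun p => ?_)
  · have h1 : Continuous fun p : X × Y => (U p.1 : K) :=
      continuous_subtype_val.comp (hU.comp continuous_fst)
    have h2 : Continuous fun p : X × Y => (U' p.2 : K) :=
      continuous_subtype_val.comp (hU'.comp continuous_snd)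
    have h3 := h1.inner (𝕜 := ℂ) h2
    fun_prop
  · rw [show ∀ r : ℝ, -I * (r : ℂ) = ((-r : ℝ) : ℂ) * I by intro r; push_cast; ring,
      Complex.norm_exp_ofReal_mul_I]

lemma smear_smear {c : X → ℂ} (hc : Integrable c) {U : X → V} (hU : Continuous U)
    {c' : Y → ℂ} (hc' : Integrable c') {U' : Y → V} (hU' : Continuous U') (ξ : H) :
    w.smear hc hU (w.smear hc' hU' ξ) = ∫ p : X × Y,
      (c p.1 * c' p.2 * cexp (-I * (⟪(U p.1 : K), (U' p.2 : K)⟫_ℂ).im)) •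
        w.op (U p.1 + U' p.2) ξ := by
  have hi := w.integrable_smul_op (integrable_mul_phase hc hU hc' hU')
    (U := fun p => U p.1 + U' p.2) ((hU.comp continuous_fst).add (hU'.comp continuous_snd)) ξ
  rw [Measure.volume_eq_prod, integral_prod _ hi, smear_apply]
  refine integral_congr_ae (.of_forall fun x => ?_)
  simp only
  rw [smear_apply, ← ContinuousLinearMap.integral_comp_comm _ (w.integrable_smul_op hc' hU' ξ),
    ← integral_smul]
  refine integral_congr_ae (.of_forall fun y => ?_)
  simp only [map_smul, w.op_op, smul_smul]
  congr 1
  simp only [AddSubgroup.subtype_apply]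
  ring

end WeylSystem

/-! ### Time-ordered products and the Dyson series -/

/-- The quadratic form in the phase of a product in which the factors in `s` come first in reverse
order, followed by the remaining factors in order: `θ` is the symmetric kernel of an ordered
product, `-θ` that of a reversed one, and the symplectic form `σ` enters through the Weyl
relations. -/
def orderPhase {ι : Type*} [Fintype ι] [DecidableEq ι] (θ σ : ι → ι → ℝ) (s : Finset ι) : ℝ :=
  -(∑ i ∈ s, ∑ k ∈ s, θ i k) + (∑ i ∈ sᶜ, ∑ k ∈ sᶜ, θ i k) + 2 * ∑ i ∈ s, ∑ k ∈ sᶜ, σ i k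

/-- A factor `j` with `θ j k = σ j k` for all `k` is last in any reversed product and first in any
ordered one, so that it can be moved from one to the other. -/
lemma orderPhase_insert {ι : Type*} [Fintype ι] [DecidableEq ι] {θ σ : ι → ι → ℝ}
    (hθ : ∀ i k, θ i k = θ k i) (hσ : ∀ i k, σ i k = -σ k i) {j : ι}
    (hj : ∀ k, θ j k = σ j k) {s : Finset ι} (hs : j ∉ s) :
    orderPhase θ σ (insert j s) = orderPhase θ σ s := by
  obtain ⟨t, ht, htc⟩ : ∃ t : Finset ι, j ∉ t ∧ sᶜ = insert j t :=
    ⟨sᶜ.erase j, by simp, (Finset.insert_erase (by simpa using hs)).symm⟩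
  have hins : (insert j s)ᶜ = t := by
    rw [Finset.compl_insert, htc, Finset.erase_insert ht]
  have hjj : σ j j = 0 := by linarith [hσ j j]
  have h1 : ∀ i, θ i j = σ j i := fun i => by rw [hθ, hj]
  have h2 : ∑ i ∈ s, σ i j = -∑ i ∈ s, σ j i := by
    rw [← Finset.sum_neg_distrib]
    exact Finset.sum_congr rfl fun i _ => hσ i j
  simp only [orderPhase, hins, htc, Finset.sum_insert hs, Finset.sum_insert ht,
    Finset.sum_add_distrib, hj, h1, h2, hjj]
  ring

/-- The alternating sum over all ways to split a product into a reversed and an ordered part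
vanishes. -/
lemma sum_orderPhase_eq_zero {ι : Type*} [Fintype ι] [DecidableEq ι] {θ σ : ι → ι → ℝ}
    (hθ : ∀ i k, θ i k = θ k i) (hσ : ∀ i k, σ i k = -σ k i) {j : ι}
    (hj : ∀ k, θ j k = σ j k) :
    ∑ s ∈ (Finset.univ : Finset ι).powerset,
      (-1 : ℂ) ^ s.card * cexp (-(I / 2) * orderPhase θ σ s) = 0 := by
  rw [← Finset.insert_erase (Finset.mem_univ j), Finset.sum_powerset_insert (by simp),
    ← Finset.sum_add_distrib]
  refine Finset.sum_eq_zero fun s hs => ?_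
  have hjs : j ∉ s := fun h => by simpa using Finset.mem_powerset.1 hs h
  rw [orderPhase_insert hθ hσ hj hjs, Finset.card_insert_of_notMem hjs, pow_succ]
  ring

/-- An interaction vertex: an integrable complex weight and a continuous family of one-particle
vectors on a parameter space. It stands for the operator `∫ weight(z) W(vec(z)) dz`. -/
structure Vertex {K : Type*} [NormedAddCommGroup K] (V : AddSubgroup K) (Z : Type*)
    [TopologicalSpace Z] [MeasureSpace Z] where
  vec : Z → V
  continuous_vec : Continuous vec
  weight : Z → ℂ
  integrable_weight : Integrable weight

namespace Vertex

variable {K H : Type*} [NormedAddCommGroup K] [InnerProductSpace ℂ K]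
  [NormedAddCommGroup H] [InnerProductSpace ℂ H] {V : AddSubgroup K}
  (w : WeylSystem V.subtype H)
  {Z : Type*} [TopologicalSpace Z] [SecondCountableTopology Z] [MeasureSpace Z] [BorelSpace Z]
  [SigmaFinite (volume : Measure Z)] (v : Vertex V Z) {θ : Z → Z → ℝ}

/-- The coefficient of the Weyl operator in an ordered product of vertices. The order is encoded in
the phase: `θ z z'` is the symplectic form of the two vectors, the factor further to the left
first. -/
def coeff (θ : Z → Z → ℝ) {ι : Type*} [Fintype ι] (z : ι → Z) : ℂ :=
  (∏ i, v.weight (z i)) * cexp (-(I / 2) * (∑ i, ∑ k, θ (z i) (z k) : ℝ))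

/-- The sum of the one-particle vectors of several vertices. -/
def totalVec {ι : Type*} [Fintype ι] (z : ι → Z) : V := ∑ i, v.vec (z i)

lemma continuous_totalVec {ι : Type*} [Fintype ι] : Continuous (v.totalVec (ι := ι)) :=
  continuous_finsetSum _ fun i _ => v.continuous_vec.comp (continuous_apply i)

lemma norm_coeff {ι : Type*} [Fintype ι] (z : ι → Z) :
    ‖v.coeff θ z‖ = ∏ i, ‖v.weight (z i)‖ := by
  rw [coeff, norm_mul, norm_prod, show -(I / 2) * ((∑ i, ∑ k, θ (z i) (z k) : ℝ) : ℂ)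
    = ((-(∑ i, ∑ k, θ (z i) (z k)) / 2 : ℝ) : ℂ) * I by push_cast; ring,
    Complex.norm_exp_ofReal_mul_I, mul_one]

lemma integrable_coeff (hθ : Continuous (Function.uncurry θ)) {ι : Type*} [Fintype ι] :
    Integrable (v.coeff θ : (ι → Z) → ℂ) := by
  have hp : Integrable fun z : ι → Z => ∏ i, v.weight (z i) :=
    Integrable.fintype_prod fun _ => v.integrable_weight
  refine hp.norm.mono' (hp.aestronglyMeasurable.mul (Continuous.aestronglyMeasurable ?_))
    (.of_forall fun z => ?_)
  · have : ∀ i k, Continuous fun z : ι → Z => θ (z i) (z k) := fun i k =>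
      hθ.comp (f := fun z : ι → Z => (z i, z k)) ((continuous_apply i).prodMk (continuous_apply k))
    fun_prop
  · rw [norm_coeff, norm_prod]

/-- The ordered product of copies of the vertex indexed by `ι`, in Weyl form. -/
def ordered (hθ : Continuous (Function.uncurry θ)) (ι : Type*) [Fintype ι] : H →L[ℂ] H :=
  w.smear (v.integrable_coeff hθ (ι := ι)) v.continuous_totalVec

lemma norm_ordered_le (hθ : Continuous (Function.uncurry θ)) (ι : Type*) [Fintype ι] :
    ‖v.ordered w hθ ι‖ ≤ (∫ z, ‖v.weight z‖) ^ Fintype.card ι := by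
  refine (w.norm_smear_le _ _).trans_eq ?_
  simp only [norm_coeff]
  exact integral_fintype_prod_eq_pow fun z => ‖v.weight z‖

lemma ordered_congr (hθ : Continuous (Function.uncurry θ)) {ι κ : Type*} [Fintype ι]
    [hκ : Fintype κ]
    (e : ι ≃ κ) : v.ordered w hθ ι = v.ordered w hθ κ := by
  ext ξ
  simp only [ordered, WeylSystem.smear_apply]
  rw [← (volume_measurePreserving_piCongrLeft (fun _ : κ => Z) e).integral_comp'
    (fun x : κ → Z => v.coeff θ x • w.op (v.totalVec x) ξ)]
  refine integral_congr_ae (.of_forall fun z => ?_)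
  have h : ∀ i, MeasurableEquiv.piCongrLeft (fun _ : κ => Z) e z (e i) = z i :=
    fun i => Equiv.piCongrLeft_apply_apply (fun _ : κ => Z) e z i
  simp only [coeff, totalVec, ← e.sum_comp, ← e.prod_comp, h]

/-- The coefficient of the product of the vertices in `s` in reverse order and of the remaining ones
in order. -/
def splitCoeff (θ : Z → Z → ℝ) {ι : Type*} [Fintype ι] [DecidableEq ι] (s : Finset ι)
    (z : ι → Z) : ℂ :=
  (∏ i, v.weight (z i)) * cexp (-(I / 2) * orderPhase (fun i k => θ (z i) (z k))
    (fun i k => (⟪(v.vec (z i) : K), (v.vec (z k) : K)⟫_ℂ).im) s)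

lemma totalVec_split {ι : Type*} [Fintype ι] (p : ι → Prop) [DecidablePred p] (z : ι → Z) :
    v.totalVec (fun i : Subtype p => z i) + v.totalVec (fun i : {i // ¬p i} => z i)
      = v.totalVec z :=
  Fintype.sum_subtype_add_sum_subtype p fun i => v.vec (z i)

lemma coeff_mul_coeff {ι : Type*} [Fintype ι] [DecidableEq ι] {s : Finset ι} {p : ι → Prop}
    [DecidablePred p] (hs : ∀ i, i ∈ s ↔ p i) (z : ι → Z) :
    v.coeff (fun z z' => -θ z z') (fun i : Subtype p => z i)
        * v.coeff θ (fun i : {i // ¬p i} => z i)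
        * cexp (-I * (⟪(v.totalVec (fun i : Subtype p => z i) : K),
          (v.totalVec (fun i : {i // ¬p i} => z i) : K)⟫_ℂ).im)
      = v.splitCoeff θ s z := by
  have hcompl : ∀ f : ι → ℝ, ∑ i : {i // ¬p i}, f i = ∑ i ∈ sᶜ, f i := fun f =>
    (Finset.sum_subtype sᶜ (by simp [hs]) f).symm
  have hmem : ∀ f : ι → ℝ, ∑ i : Subtype p, f i = ∑ i ∈ s, f i := fun f =>
    (Finset.sum_subtype s hs f).symm
  have hin : (⟪(v.totalVec (fun i : Subtype p => z i) : K),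
      (v.totalVec (fun i : {i // ¬p i} => z i) : K)⟫_ℂ).im
      = ∑ i ∈ s, ∑ k ∈ sᶜ, (⟪(v.vec (z i) : K), (v.vec (z k) : K)⟫_ℂ).im := by
    simp only [totalVec, AddSubgroup.val_finsetSum, sum_inner, inner_sum, Complex.im_sum]
    rw [Finset.sum_comm, ← hmem fun i => ∑ k ∈ sᶜ, (⟪(v.vec (z i) : K), (v.vec (z k) : K)⟫_ℂ).im]
    exact Finset.sum_congr rfl fun i _ =>
      hcompl fun k => (⟪(v.vec (z i) : K), (v.vec (z k) : K)⟫_ℂ).im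
  have h1 : ∑ i : Subtype p, ∑ k : Subtype p, -θ (z i) (z k)
      = -∑ i ∈ s, ∑ k ∈ s, θ (z i) (z k) := by
    rw [← hmem fun i => ∑ k ∈ s, θ (z i) (z k)]
    simp only [Finset.sum_neg_distrib]
    congr 1
    exact Finset.sum_congr rfl fun i _ => hmem fun k => θ (z i) (z k)
  have h2 : ∑ i : {i // ¬p i}, ∑ k : {i // ¬p i}, θ (z i) (z k)
      = ∑ i ∈ sᶜ, ∑ k ∈ sᶜ, θ (z i) (z k) := by
    rw [← hcompl fun i => ∑ k ∈ sᶜ, θ (z i) (z k)]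
    exact Finset.sum_congr rfl fun i _ => hcompl fun k => θ (z i) (z k)
  rw [hin, coeff, coeff, h1, h2, splitCoeff, orderPhase,
    ← Fintype.prod_subtype_mul_prod_subtype p fun i => v.weight (z i), mul_mul_mul_comm,
    ← Complex.exp_add, mul_assoc, ← Complex.exp_add]
  congr 2
  push_cast
  ring

lemma integrable_splitCoeff (hθ : Continuous (Function.uncurry θ)) {ι : Type*} [Fintype ι]
    [DecidableEq ι] (s : Finset ι) : Integrable (v.splitCoeff θ s) := by
  have hp : Integrable fun z : ι → Z => ∏ i, v.weight (z i) :=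
    Integrable.fintype_prod fun _ => v.integrable_weight
  refine hp.mul_bdd (c := 1) (Continuous.aestronglyMeasurable ?_) (.of_forall fun z => ?_)
  · have h1 : ∀ i k, Continuous fun z : ι → Z => θ (z i) (z k) := fun i k =>
      hθ.comp (f := fun z : ι → Z => (z i, z k)) ((continuous_apply i).prodMk (continuous_apply k))
    have h2 : ∀ i, Continuous fun z : ι → Z => (v.vec (z i) : K) := fun i =>
      continuous_subtype_val.comp (v.continuous_vec.comp (continuous_apply i))
    have h3 : ∀ i k, Continuous fun z : ι → Z => ⟪(v.vec (z i) : K), (v.vec (z k) : K)⟫_ℂ :=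
      fun i k => (h2 i).inner (h2 k)
    unfold orderPhase
    fun_prop
  · rw [show ∀ r : ℝ, -(I / 2) * (r : ℂ) = ((-r / 2 : ℝ) : ℂ) * I by intro r; push_cast; ring,
      Complex.norm_exp_ofReal_mul_I]

variable [CompleteSpace H]

/-- The product of the vertices in `s` in reverse order and of the remaining ones in order, as one
integral over all vertices. -/
lemma ordered_neg_ordered (hθ : Continuous (Function.uncurry θ))
    (hθ' : Continuous (Function.uncurry fun z z' => -θ z z')) {ι : Type*} [Fintype ι]
    [DecidableEq ι] {s : Finset ι} {p : ι → Prop} [DecidablePred p] (hs : ∀ i, i ∈ s ↔ p i)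
    (ξ : H) :
    v.ordered w hθ' (Subtype p) (v.ordered w hθ {i // ¬p i} ξ)
      = ∫ z : ι → Z, v.splitCoeff θ s z • w.op (v.totalVec z) ξ := by
  rw [ordered, ordered, WeylSystem.smear_smear,
    ← (volume_preserving_piEquivPiSubtypeProd (fun _ : ι => Z) p).integral_comp']
  refine integral_congr_ae (.of_forall fun z => ?_)
  simp only [← v.coeff_mul_coeff hs z, ← v.totalVec_split p z]
  rfl

/-- The alternating sum over all ways to split the vertices into a reversed and an ordered part
vanishes if some vertex of every configuration can be moved from one part to the other. -/
lemma sum_ordered_neg_ordered (hθ : Continuous (Function.uncurry θ))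
    (hθ' : Continuous (Function.uncurry fun z z' => -θ z z'))
    (hsymm : ∀ z z', θ z z' = θ z' z) {ι : Type*} [Fintype ι] [DecidableEq ι]
    (hext : ∀ z : ι → Z, ∃ j, ∀ k,
      θ (z j) (z k) = (⟪(v.vec (z j) : K), (v.vec (z k) : K)⟫_ℂ).im) (ξ : H) :
    ∑ s ∈ (Finset.univ : Finset ι).powerset, (-1 : ℂ) ^ s.card •
      v.ordered w hθ' (Fin s.card) (v.ordered w hθ (Fin (Fintype.card ι - s.card)) ξ) = 0 := by
  have h1 : ∀ s : Finset ι,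
      v.ordered w hθ' (Fin s.card) (v.ordered w hθ (Fin (Fintype.card ι - s.card)) ξ)
      = ∫ z : ι → Z, v.splitCoeff θ s z • w.op (v.totalVec z) ξ := by
    intro s
    rw [← v.ordered_neg_ordered w hθ hθ' (p := (· ∈ s)) (fun _ => Iff.rfl),
      v.ordered_congr w hθ (Fintype.equivFinOfCardEq
        (by simp : Fintype.card {i // i ∉ s} = Fintype.card ι - s.card))]
    exact DFunLike.congr_fun (ordered_congr w v (κ := Subtype (· ∈ s)) hθ'
      (hκ := Subtype.fintype _) s.equivFin.symm) _
  simp only [h1, ← integral_smul]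
  rw [← integral_finsetSum (f := fun (s : Finset ι) z =>
    (-1 : ℂ) ^ s.card • v.splitCoeff θ s z • w.op (v.totalVec z) ξ) _ fun s _ =>
    (w.integrable_smul_op (v.integrable_splitCoeff hθ s) v.continuous_totalVec ξ).smul _]
  refine integral_eq_zero_of_ae (.of_forall fun z => ?_)
  obtain ⟨j, hj⟩ := hext z
  have h0 := sum_orderPhase_eq_zero (θ := fun i k => θ (z i) (z k))
    (σ := fun i k => (⟪(v.vec (z i) : K), (v.vec (z k) : K)⟫_ℂ).im) (fun i k => hsymm _ _)
    (fun i k => by rw [← inner_conj_symm, Complex.conj_im]) hj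
  simp only [smul_smul, splitCoeff, ← Finset.sum_smul, mul_left_comm ((-1 : ℂ) ^ _),
    ← Finset.mul_sum, h0, Pi.zero_apply, mul_zero, zero_smul]

/-- The term of order `n` of the ordered exponential of `c` times the vertex. -/
def expTerm (hθ : Continuous (Function.uncurry θ)) (c : ℂ) (n : ℕ) : H →L[ℂ] H :=
  (c ^ n / (n.factorial : ℂ)) • v.ordered w hθ (Fin n)

lemma expTerm_zero (hθ : Continuous (Function.uncurry θ)) (c : ℂ) : v.expTerm w hθ c 0 = 1 := by
  ext ξ
  simp [expTerm, ordered, WeylSystem.smear_apply, coeff, totalVec, w.op_zero, volume_pi,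
    Measure.real]

lemma summable_norm_expTerm (hθ : Continuous (Function.uncurry θ)) (c : ℂ) :
    Summable fun n => ‖v.expTerm w hθ c n‖ := by
  refine Summable.of_nonneg_of_le (fun _ => norm_nonneg _) (fun n => ?_)
    (Real.summable_pow_div_factorial (‖c‖ * ∫ z, ‖v.weight z‖))
  rw [expTerm, norm_smul, norm_div, norm_pow, Complex.norm_natCast, mul_pow, mul_div_right_comm]
  gcongr
  simpa using v.norm_ordered_le w hθ (Fin n)

/-- The positive orders of the Cauchy product of the reversed and the ordered exponential vanish:
the binomial coefficients count the ways to split `n` vertices. -/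
lemma sum_antidiagonal_expTerm (hθ : Continuous (Function.uncurry θ))
    (hθ' : Continuous (Function.uncurry fun z z' => -θ z z'))
    (hsymm : ∀ z z', θ z z' = θ z' z)
    (hext : ∀ n : ℕ, 0 < n → ∀ z : Fin n → Z, ∃ j, ∀ k,
      θ (z j) (z k) = (⟪(v.vec (z j) : K), (v.vec (z k) : K)⟫_ℂ).im) (c : ℂ) {n : ℕ} (hn : n ≠ 0) :
    ∑ kl ∈ Finset.HasAntidiagonal.antidiagonal n,
      v.expTerm w hθ' (-c) kl.1 * v.expTerm w hθ c kl.2 = 0 := by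
  ext ξ
  have h0 := v.sum_ordered_neg_ordered w hθ hθ' hsymm (hext n (Nat.pos_of_ne_zero hn)) ξ
  rw [Fintype.card_fin] at h0
  rw [Finset.sum_powerset_apply_card (fun k => (-1 : ℂ) ^ k •
    v.ordered w hθ' (Fin k) (v.ordered w hθ (Fin (n - k)) ξ)), Finset.card_univ,
    Fintype.card_fin] at h0
  rw [Finset.Nat.sum_antidiagonal_eq_sum_range_succ
    (fun k l => v.expTerm w hθ' (-c) k * v.expTerm w hθ c l), sum_apply,
    zero_apply, ← smul_zero (c ^ n / (n.factorial : ℂ)), ← h0, Finset.smul_sum]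
  refine Finset.sum_congr rfl fun k hk => ?_
  have hkn : k ≤ n := Nat.lt_succ_iff.1 (Finset.mem_range.1 hk)
  simp only [expTerm, mul_apply_eq_comp, smul_apply, map_smul,
    ← Nat.cast_smul_eq_nsmul ℂ, smul_smul]
  congr 1
  have hf := Nat.choose_mul_factorial_mul_factorial hkn
  have hf' : (n.choose k : ℂ) * k.factorial * (n - k).factorial = n.factorial := by
    exact_mod_cast hf
  have hc : c ^ n = c ^ k * c ^ (n - k) := by rw [← pow_add, Nat.add_sub_cancel' hkn]
  have hk0 : (k.factorial : ℂ) ≠ 0 := by exact_mod_cast k.factorial_ne_zero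
  have hnk0 : ((n - k).factorial : ℂ) ≠ 0 := by exact_mod_cast (n - k).factorial_ne_zero
  have hn0 : (n.factorial : ℂ) ≠ 0 := by exact_mod_cast n.factorial_ne_zero
  rw [hc, neg_pow]
  field_simp
  rw [← hf']
  ring

/-- The adjoint reverses the order, for a vertex that is hermitian with respect to an involution of
the parameter space. -/
lemma adjoint_ordered (hθ : Continuous (Function.uncurry θ))
    (hθ' : Continuous (Function.uncurry fun z z' => -θ z z')) (e : Z ≃ᵐ Z)
    (he : MeasurePreserving e) (hvec : ∀ z, v.vec (e z) = -v.vec z)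
    (hweight : ∀ z, v.weight (e z) = conj (v.weight z)) (hθe : ∀ z z', θ (e z) (e z') = θ z z')
    (ι : Type*) [Fintype ι] :
    ContinuousLinearMap.adjoint (v.ordered w hθ ι) = v.ordered w hθ' ι := by
  symm
  rw [ContinuousLinearMap.eq_adjoint_iff]
  intro ξ η
  rw [← inner_conj_symm, ← inner_conj_symm ξ]
  congr 1
  rw [ordered, ordered, WeylSystem.inner_smear_left, WeylSystem.smear_apply]
  congr 1
  rw [← (volume_preserving_pi (ι := ι) fun _ => he).integral_comp
    (MeasurableEquiv.piCongrRight fun _ : ι => e).measurableEmbedding]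
  refine integral_congr_ae (.of_forall fun z => ?_)
  have h1 : conj (v.coeff θ z) = v.coeff (fun z z' => -θ z z') fun i => e (z i) := by
    simp only [coeff, map_mul, map_prod, hweight, hθe, ← Complex.exp_conj]
    congr 2
    simp only [map_neg, map_div₀, Complex.conj_I, Complex.conj_ofReal, Finset.sum_neg_distrib,
      Complex.conj_ofNat]
    push_cast
    ring
  have h2 : -v.totalVec z = v.totalVec fun i => e (z i) := by
    simp [totalVec, hvec]
  simp only [h1, h2]

lemma tsum_expTerm_neg_mul_tsum_expTerm (hθ : Continuous (Function.uncurry θ))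
    (hθ' : Continuous (Function.uncurry fun z z' => -θ z z'))
    (hsymm : ∀ z z', θ z z' = θ z' z)
    (hext : ∀ n : ℕ, 0 < n → ∀ z : Fin n → Z, ∃ j, ∀ k,
      θ (z j) (z k) = (⟪(v.vec (z j) : K), (v.vec (z k) : K)⟫_ℂ).im) (c : ℂ) :
    (∑' n, v.expTerm w hθ' (-c) n) * ∑' n, v.expTerm w hθ c n = 1 := by
  rw [tsum_mul_tsum_eq_tsum_sum_antidiagonal_of_summable_norm
    (v.summable_norm_expTerm w hθ' (-c)) (v.summable_norm_expTerm w hθ c), tsum_eq_single 0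
    fun n hn => v.sum_antidiagonal_expTerm w hθ hθ' hsymm hext c hn]
  simp [expTerm_zero]

/-- The Dyson series of a hermitian vertex is unitary: here `θ` is the imaginary part of the Feynman
propagator, which agrees with the symplectic form for points in time order. -/
theorem exists_unitary_hasSum_expTerm (hθ : Continuous (Function.uncurry θ))
    (hsymm : ∀ z z', θ z z' = θ z' z) (τ : Z → ℝ)
    (hτ : ∀ z z', τ z' ≤ τ z → θ z z' = (⟪(v.vec z : K), (v.vec z' : K)⟫_ℂ).im) (e : Z ≃ᵐ Z)
    (he : MeasurePreserving e) (hvec : ∀ z, v.vec (e z) = -v.vec z)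
    (hweight : ∀ z, v.weight (e z) = conj (v.weight z)) (hθe : ∀ z z', θ (e z) (e z') = θ z z') :
    ∃ U ∈ unitary (H →L[ℂ] H), HasSum (fun n => v.expTerm w hθ I n) U := by
  have hθ' : Continuous (Function.uncurry fun z z' => -θ z z') := hθ.neg
  have hθ'' : Continuous (Function.uncurry fun z z' => - -θ z z') := hθ.neg.neg
  have hlatest : ∀ n : ℕ, 0 < n → ∀ z : Fin n → Z, ∃ j, ∀ k,
      θ (z j) (z k) = (⟪(v.vec (z j) : K), (v.vec (z k) : K)⟫_ℂ).im := by
    intro n hn z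
    have : Nonempty (Fin n) := ⟨⟨0, hn⟩⟩
    -- the latest vertex
    obtain ⟨j, hj⟩ := Finite.exists_max fun i => τ (z i)
    exact ⟨j, fun k => hτ _ _ (hj k)⟩
  have hearliest : ∀ n : ℕ, 0 < n → ∀ z : Fin n → Z, ∃ j, ∀ k,
      -θ (z j) (z k) = (⟪(v.vec (z j) : K), (v.vec (z k) : K)⟫_ℂ).im := by
    intro n hn z
    have : Nonempty (Fin n) := ⟨⟨0, hn⟩⟩
    -- the earliest vertex, since `-θ` describes the reverse order
    obtain ⟨j, hj⟩ := Finite.exists_min fun i => τ (z i)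
    refine ⟨j, fun k => ?_⟩
    rw [hsymm, hτ _ _ (hj k), ← inner_conj_symm, Complex.conj_im, neg_neg]
  have hS := (v.summable_norm_expTerm w hθ I).of_norm
  have hadj : ∀ n, star (v.expTerm w hθ I n) = v.expTerm w hθ' (-I) n := by
    intro n
    rw [expTerm, star_smul, ContinuousLinearMap.star_eq_adjoint,
      v.adjoint_ordered w hθ hθ' e he hvec hweight hθe, expTerm]
    simp
  have hstar : star (∑' n, v.expTerm w hθ I n) = ∑' n, v.expTerm w hθ' (-I) n := by
    rw [← hS.hasSum.star.tsum_eq]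
    exact tsum_congr hadj
  refine ⟨∑' n, v.expTerm w hθ I n, Unitary.mem_iff.2 ⟨?_, ?_⟩, hS.hasSum⟩
  · rw [hstar]
    exact v.tsum_expTerm_neg_mul_tsum_expTerm w hθ hθ' hsymm hlatest I
  · have h := v.tsum_expTerm_neg_mul_tsum_expTerm w hθ' hθ''
      (fun z z' => congrArg Neg.neg (hsymm z z')) hearliest (-I)
    simp only [neg_neg] at h
    rw [hstar]
    exact h

end Vertex

/-! ### One-particle vectors -/

section OneParticle

variable {d : ℕ} {m : ℝ}

/-- The one-particle space; a function `F` on the mass shell is encoded by `onShell m F`. -/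
abbrev OneParticle (d : ℕ) := Lp ℂ 2 (volume : Measure (Space d))

/-- A function on the mass shell times the square root of the density of the invariant measure,
which makes its norm that of `L²(ℝ^(d-1))`. -/
def onShell (m : ℝ) (F : Space d → ℂ) (p : Space d) : ℂ := (√(modeWeight d m p) : ℂ) * F p

lemma modeWeight_continuous (hm : 0 < m) : Continuous fun p : Space d => modeWeight d m p := by
  unfold modeWeight
  have h := energy_continuous (d := d) m
  refine continuous_const.div (by fun_prop) fun p => ?_
  have := hm.trans_le (energy_ge m p)
  positivity

lemma modeWeight_le (hm : 0 < m) (p : Space d) :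
    modeWeight d m p ≤ 1 / ((2 * Real.pi) ^ (d - 1) * (2 * m)) := by
  unfold modeWeight
  have := energy_ge m p
  gcongr

lemma inner_toLp_onShell {F G : Space d → ℂ} (hF : MemLp (onShell m F) 2)
    (hG : MemLp (onShell m G) 2) :
    ⟪hF.toLp, hG.toLp⟫_ℂ = ∫ p, modeWeight d m p * (conj (F p) * G p) := by
  rw [L2.inner_def]
  refine integral_congr_ae ?_
  filter_upwards [hF.coeFn_toLp, hG.coeFn_toLp] with p h1 h2
  rw [h1, h2, RCLike.inner_apply]
  simp only [onShell, map_mul, Complex.conj_ofReal]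
  have h3 : (√(modeWeight d m p) : ℂ) * (√(modeWeight d m p) : ℂ) = modeWeight d m p := by
    rw [← Complex.ofReal_mul, Real.mul_self_sqrt (modeWeight_nonneg m p)]
  linear_combination (conj (F p) * G p) * h3

lemma memLp_onShell_of_norm_le (hm : 0 < m) {F : Space d → ℂ} (hF : Continuous F)
    {s : 𝓢(Space d, ℂ)} (hs : ∀ p, ‖F p‖ ≤ ‖s p‖) : MemLp (onShell m F) 2 := by
  refine (s.memLp 2).of_le_mul (c := √(1 / ((2 * Real.pi) ^ (d - 1) * (2 * m))))
    (Continuous.aestronglyMeasurable ?_) (.of_forall fun p => ?_)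
  · have := (modeWeight_continuous (d := d) hm).sqrt
    unfold onShell
    fun_prop
  · rw [onShell, norm_mul, Complex.norm_of_nonneg (Real.sqrt_nonneg _)]
    gcongr
    · exact modeWeight_le hm p
    · exact hs p

lemma memLp_shell (hm : 0 < m) (h : TestFn d) : MemLp (onShell m (shell m h)) 2 := by
  have hc : Continuous (onShell m (shell m h)) := by
    have h1 := (modeWeight_continuous (d := d) hm).sqrt
    have h2 := shell_continuous m h
    unfold onShell
    fun_prop
  rw [memLp_two_iff_integrable_sq_norm hc.aestronglyMeasurable]
  refine (twoPoint_integrable hm h h).norm.congr (.of_forall fun p => ?_)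
  simp only [onShell, norm_mul, RCLike.norm_conj, Complex.norm_of_nonneg (modeWeight_nonneg m p),
    Complex.norm_of_nonneg (Real.sqrt_nonneg _), mul_pow, Real.sq_sqrt (modeWeight_nonneg m p)]
  ring

/-- The one-particle vector of a test function. -/
def shellVec (d : ℕ) (hm : 0 < m) : TestFn d →+ OneParticle d :=
  AddMonoidHom.mk' (fun h => (memLp_shell hm h).toLp) fun f g => by
    rw [← MemLp.toLp_add]
    refine MemLp.toLp_congr _ _ (.of_forall fun p => ?_)
    simp only [onShell, shell_add, Pi.add_apply]
    ring

lemma shellVec_apply (hm : 0 < m) (h : TestFn d) : shellVec d hm h = (memLp_shell hm h).toLp := rfl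

lemma inner_shellVec (hm : 0 < m) (f g : TestFn d) :
    ⟪shellVec d hm f, shellVec d hm g⟫_ℂ = twoPoint m f g :=
  inner_toLp_onShell (memLp_shell hm f) (memLp_shell hm g)

/-! ### The regularized field at a point -/

section Cutoff

variable {χ : Space d → ℝ} {Λ : ℝ}

lemma exists_schwartz_chiHat (hχ : IsCutoff χ) (hΛ : 0 < Λ) :
    ∃ s : 𝓢(Space d, ℂ), ∀ p, s p = chiHat χ (Λ • p) := by
  let s₀ : 𝓢(Space d, ℂ) := HasCompactSupport.toSchwartzMap (f := fun x => (χ x : ℂ))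
    (hχ.hasCompactSupport.comp_left (g := fun r : ℝ => (r : ℂ)) (by simp))
    (Complex.ofRealCLM.contDiff.comp hχ.contDiff)
  have hc : Λ / (2 * Real.pi) ≠ 0 := by positivity
  refine ⟨SchwartzMap.compCLMOfContinuousLinearEquiv ℝ
    (ContinuousLinearEquiv.smulLeft (Units.mk0 _ hc)) (𝓕 s₀), fun p => ?_⟩
  have h1 : SchwartzMap.compCLMOfContinuousLinearEquiv ℝ
    (ContinuousLinearEquiv.smulLeft (Units.mk0 _ hc)) (𝓕 s₀) p
      = 𝓕 s₀ ((Λ / (2 * Real.pi)) • p) := rfl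
  rw [h1, SchwartzMap.fourier_coe, Real.fourier_eq', chiHat]
  refine integral_congr_ae (.of_forall fun x => ?_)
  have h2 : s₀ x = χ x := rfl
  simp only [h2, smul_eq_mul, inner_smul_right, inner_smul_left, real_inner_comm x p]
  congr 2
  have : (Real.pi : ℂ) ≠ 0 := by exact_mod_cast Real.pi_ne_zero
  simp
  field_simp

lemma chiHat_neg (hχ : IsCutoff χ) (p : Space d) : chiHat χ (-p) = chiHat χ p := by
  rw [chiHat, ← integral_neg_eq_self, chiHat]
  simp only [inner_neg_neg, hχ.symmetric]

lemma conj_chiHat (hχ : IsCutoff χ) (p : Space d) : conj (chiHat χ p) = chiHat χ p := by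
  refine Eq.trans ?_ (chiHat_neg hχ p)
  rw [chiHat, chiHat, ← integral_conj]
  refine integral_congr_ae (.of_forall fun x => ?_)
  simp [← Complex.exp_conj]

lemma phaseArg_continuous (m : ℝ) :
    Continuous fun q : Space d × Minkowski d => phaseArg m q.1 q.2 := by
  have := energy_continuous (d := d) m
  unfold phaseArg
  fun_prop

lemma phaseArg_sub (m : ℝ) (p : Space d) (x y : Minkowski d) :
    phaseArg m p (x - y) = phaseArg m p x - phaseArg m p y := by
  simp only [phaseArg, Prod.fst_sub, Prod.snd_sub, inner_sub_right]
  ring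

lemma norm_exp_I_mul (r : ℝ) : ‖cexp (I * r)‖ = 1 := by
  rw [mul_comm, Complex.norm_exp_ofReal_mul_I]

lemma norm_exp_neg_I_mul (r : ℝ) : ‖cexp (-I * r)‖ = 1 := by
  rw [show -I * (r : ℂ) = ((-r : ℝ) : ℂ) * I by push_cast; ring, Complex.norm_exp_ofReal_mul_I]

/-- The restriction to the mass shell of the Fourier transform of the regularized delta function
`G_Λ(x - ·)`. -/
def pointMode (m : ℝ) (χ : Space d → ℝ) (Λ : ℝ) (x : Minkowski d) (p : Space d) : ℂ :=
  cexp (-I * phaseArg m p x) * chiHat χ (Λ • p)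

lemma chiHat_smul_continuous (hχ : IsCutoff χ) (hΛ : 0 < Λ) :
    Continuous fun p : Space d => chiHat χ (Λ • p) := by
  obtain ⟨s, hs⟩ := exists_schwartz_chiHat hχ hΛ
  simp only [← hs]
  exact s.continuous

lemma memLp_pointMode (hm : 0 < m) (hχ : IsCutoff χ) (hΛ : 0 < Λ) (x : Minkowski d) :
    MemLp (onShell m (pointMode m χ Λ x)) 2 := by
  obtain ⟨s, hs⟩ := exists_schwartz_chiHat hχ hΛ
  refine memLp_onShell_of_norm_le hm (s := s) ?_ fun p => ?_
  · have h1 := chiHat_smul_continuous hχ hΛ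
    have h2 := (phaseArg_continuous m).comp (Continuous.prodMk_left x)
    simp only [Function.comp_def] at h2
    unfold pointMode
    fun_prop
  · rw [pointMode, norm_mul, norm_exp_neg_I_mul, one_mul, hs]

/-- The one-particle vector created by the regularized field at the point `x`. -/
def pointVec (hm : 0 < m) (hχ : IsCutoff χ) (hΛ : 0 < Λ) (x : Minkowski d) : OneParticle d :=
  (memLp_pointMode hm hχ hΛ x).toLp

lemma inner_pointVec (hm : 0 < m) (hχ : IsCutoff χ) (hΛ : 0 < Λ) (x y : Minkowski d) :
    ⟪pointVec hm hχ hΛ x, pointVec hm hχ hΛ y⟫_ℂ = regTwoPoint m χ Λ (x - y) := by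
  rw [pointVec, pointVec, inner_toLp_onShell, regTwoPoint]
  refine integral_congr_ae (.of_forall fun p => ?_)
  simp only [pointMode, map_mul, conj_chiHat hχ, ← Complex.exp_conj, phaseArg_sub]
  have h : cexp (I * (phaseArg m p x - phaseArg m p y : ℝ))
      = cexp (I * phaseArg m p x) * cexp (-I * phaseArg m p y) := by
    rw [← Complex.exp_add]
    congr 1
    push_cast
    ring
  simp only [map_neg, Complex.conj_I, Complex.conj_ofReal, neg_neg, h]
  ring

lemma integrable_modeWeight_mul_sq (hm : 0 < m) (s : 𝓢(Space d, ℂ)) :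
    Integrable fun p => modeWeight d m p * ‖s p‖ ^ 2 := by
  have h := (memLp_two_iff_integrable_sq_norm s.continuous.aestronglyMeasurable).1 (s.memLp 2)
  refine h.bdd_mul (c := 1 / ((2 * Real.pi) ^ (d - 1) * (2 * m)))
    (modeWeight_continuous hm).aestronglyMeasurable (.of_forall fun p => ?_)
  rw [Real.norm_of_nonneg (modeWeight_nonneg m p)]
  exact modeWeight_le hm p

lemma regTwoPoint_continuous (hm : 0 < m) (hχ : IsCutoff χ) (hΛ : 0 < Λ) :
    Continuous (regTwoPoint m χ Λ) := by
  obtain ⟨s, hs⟩ := exists_schwartz_chiHat hχ hΛ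
  have hw := modeWeight_continuous (d := d) hm
  have hph := phaseArg_continuous (d := d) m
  have hsc := s.continuous
  unfold regTwoPoint
  simp only [← hs]
  refine continuous_of_dominated (bound := fun p => modeWeight d m p * ‖s p‖ ^ 2) (fun x => ?_)
    (fun x => .of_forall fun p => ?_) (integrable_modeWeight_mul_sq hm s) (.of_forall fun p => ?_)
  · have h2 := hph.comp (Continuous.prodMk_left x)
    simp only [Function.comp_def] at h2
    exact Continuous.aestronglyMeasurable (by fun_prop)
  · rw [norm_mul, norm_mul, norm_exp_I_mul, one_mul, norm_pow,
      Complex.norm_of_nonneg (modeWeight_nonneg m p)]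
  · have h2 := hph.comp (Continuous.prodMk_right p)
    simp only [Function.comp_def] at h2
    fun_prop

/-- The regularized two-point function is invariant under spatial reflections. -/
lemma regTwoPoint_reflect (hχ : IsCutoff χ) (t : ℝ) (x : Space d) :
    regTwoPoint m χ Λ (t, -x) = regTwoPoint m χ Λ (t, x) := by
  rw [regTwoPoint, ← integral_neg_eq_self, regTwoPoint]
  simp only [modeWeight, phaseArg, energy, norm_neg, inner_neg_neg, smul_neg, chiHat_neg hχ]

lemma regFeynman_eq (x : Minkowski d) : regFeynman m χ Λ x = regTwoPoint m χ Λ (|x.1|, x.2) := by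
  unfold regFeynman
  split_ifs with h
  · rw [abs_of_nonneg h]
  · rw [abs_of_neg (not_le.1 h)]

lemma regFeynman_continuous (hm : 0 < m) (hχ : IsCutoff χ) (hΛ : 0 < Λ) :
    Continuous (regFeynman m χ Λ) := by
  have h : regFeynman m χ Λ = fun x => regTwoPoint m χ Λ (|x.1|, x.2) := funext regFeynman_eq
  rw [h]
  exact (regTwoPoint_continuous hm hχ hΛ).comp (by fun_prop)

lemma regFeynman_swap (hχ : IsCutoff χ) (x y : Minkowski d) :
    regFeynman m χ Λ (x - y) = regFeynman m χ Λ (y - x) := by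
  rw [regFeynman_eq, regFeynman_eq, ← regTwoPoint_reflect hχ, Prod.fst_sub, Prod.fst_sub,
    abs_sub_comm, Prod.snd_sub, Prod.snd_sub, neg_sub]

lemma regFeynman_of_le (hm : 0 < m) (hχ : IsCutoff χ) (hΛ : 0 < Λ) {x y : Minkowski d}
    (h : y.1 ≤ x.1) :
    regFeynman m χ Λ (x - y) = ⟪pointVec hm hχ hΛ x, pointVec hm hχ hΛ y⟫_ℂ := by
  rw [inner_pointVec, regFeynman, if_pos]
  simpa using h

lemma re_regFeynman (hm : 0 < m) (hχ : IsCutoff χ) (hΛ : 0 < Λ) (x y : Minkowski d) :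
    (regFeynman m χ Λ (x - y)).re = (⟪pointVec hm hχ hΛ x, pointVec hm hχ hΛ y⟫_ℂ).re := by
  rcases le_total y.1 x.1 with h | h
  · rw [regFeynman_of_le hm hχ hΛ h]
  · rw [regFeynman_swap hχ, regFeynman_of_le hm hχ hΛ h, ← inner_conj_symm, Complex.conj_re]

lemma continuous_pointVec (hm : 0 < m) (hχ : IsCutoff χ) (hΛ : 0 < Λ) :
    Continuous (pointVec hm hχ hΛ) := by
  rw [continuous_iff_continuousAt]
  intro x
  rw [ContinuousAt, tendsto_iff_norm_sub_tendsto_zero]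
  have hsq : ∀ y, ‖pointVec hm hχ hΛ y - pointVec hm hχ hΛ x‖
      = √(2 * (regTwoPoint m χ Λ 0).re - 2 * (regTwoPoint m χ Λ (y - x)).re) := by
    intro y
    rw [← Real.sqrt_sq (norm_nonneg _), @norm_sub_sq ℂ, ← @inner_self_eq_norm_sq ℂ,
      ← @inner_self_eq_norm_sq ℂ, inner_pointVec, inner_pointVec, inner_pointVec, sub_self,
      sub_self]
    simp only [RCLike.re_to_complex]
    ring_nf
  simp only [hsq]
  have h1 := regTwoPoint_continuous hm hχ hΛ
  have h2 : Continuous fun y => √(2 * (regTwoPoint m χ Λ 0).re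
      - 2 * (regTwoPoint m χ Λ (y - x)).re) := by fun_prop
  simpa using h2.tendsto x

end Cutoff

end OneParticle

/-! ### The regularized field at a point as a limit of smeared fields -/

section Approximation

variable {d : ℕ} {m : ℝ} {χ : Space d → ℝ} {Λ : ℝ}

lemma shell_smul (m : ℝ) (a : ℝ) (h : TestFn d) (p : Space d) :
    shell m (a • h) p = a * shell m h p := by
  rw [shell, shell, ← integral_const_mul]
  refine integral_congr_ae (.of_forall fun x => ?_)
  simp
  ring

lemma shellVec_smul (hm : 0 < m) (a : ℝ) (h : TestFn d) :
    shellVec d hm (a • h) = (a : ℂ) • shellVec d hm h := by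
  rw [shellVec_apply, shellVec_apply, ← MemLp.toLp_const_smul]
  refine MemLp.toLp_congr _ _ (.of_forall fun p => ?_)
  simp only [onShell, shell_smul, Pi.smul_apply, smul_eq_mul]
  ring

lemma smul_mem_closedRange (hm : 0 < m) (a : ℝ) {v : OneParticle d}
    (hv : v ∈ WeylSystem.closedRange (shellVec d hm)) :
    (a : ℂ) • v ∈ WeylSystem.closedRange (shellVec d hm) := by
  refine map_mem_closure (f := fun v : OneParticle d => (a : ℂ) • v) (continuous_const_smul _) hv ?_
  rintro _ ⟨h, rfl⟩
  exact ⟨a • h, shellVec_smul hm a h⟩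

/-- Convergence of one-particle vectors follows from dominated pointwise convergence on the mass
shell. -/
lemma tendsto_toLp_onShell (hm : 0 < m) {F : ℕ → Space d → ℂ} {G : Space d → ℂ}
    (hF : ∀ n, MemLp (onShell m (F n)) 2) (hG : MemLp (onShell m G) 2)
    (hFc : ∀ n, Continuous (F n)) (hGc : Continuous G) {s : 𝓢(Space d, ℂ)}
    (hFs : ∀ n p, ‖F n p‖ ≤ ‖s p‖) (hGs : ∀ p, ‖G p‖ ≤ ‖s p‖)
    (h : ∀ p, Tendsto (fun n => F n p) atTop (𝓝 (G p))) :
    Tendsto (fun n => (hF n).toLp) atTop (𝓝 hG.toLp) := by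
  have hw := modeWeight_continuous (d := d) hm
  have hsub : ∀ n, onShell m (F n) - onShell m G = onShell m (F n - G) := fun n => by
    funext p
    simp only [onShell, Pi.sub_apply]
    ring
  have hD : ∀ n, MemLp (onShell m (F n - G)) 2 := fun n => hsub n ▸ (hF n).sub hG
  have hD' : ∀ n, (hF n).toLp - hG.toLp = (hD n).toLp := fun n => by
    rw [← MemLp.toLp_sub]
    exact MemLp.toLp_congr _ _ (.of_forall fun p => congrFun (hsub n) p)
  have hsq : ∀ n, ‖(hF n).toLp - hG.toLp‖
      = √(∫ p, (modeWeight d m p : ℂ) * (conj ((F n - G) p) * (F n - G) p)).re := by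
    intro n
    rw [hD', ← inner_toLp_onShell (hD n) (hD n), @norm_eq_sqrt_re_inner ℂ]
    rfl
  rw [tendsto_iff_norm_sub_tendsto_zero]
  simp only [hsq]
  have hlim : Tendsto (fun n => ∫ p, (modeWeight d m p : ℂ) * (conj ((F n - G) p) * (F n - G) p))
      atTop (𝓝 (∫ p : Space d, (0 : ℂ))) := by
    refine tendsto_integral_of_dominated_convergence
      (fun p => 4 * (modeWeight d m p * ‖s p‖ ^ 2)) (fun n => ?_)
      ((integrable_modeWeight_mul_sq hm s).const_mul 4) (fun n => .of_forall fun p => ?_)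
      (.of_forall fun p => ?_)
    · have := hFc n
      simp only [Pi.sub_apply]
      exact Continuous.aestronglyMeasurable (by fun_prop)
    · rw [norm_mul, norm_mul, RCLike.norm_conj, Complex.norm_of_nonneg (modeWeight_nonneg m p)]
      have h1 : ‖(F n - G) p‖ ≤ 2 * ‖s p‖ := by
        have := norm_sub_le (F n p) (G p)
        rw [Pi.sub_apply]
        linarith [hFs n p, hGs p]
      have h0 := modeWeight_nonneg m p
      calc modeWeight d m p * (‖(F n - G) p‖ * ‖(F n - G) p‖)
          ≤ modeWeight d m p * ((2 * ‖s p‖) * (2 * ‖s p‖)) := by gcongr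
        _ = _ := by ring
    · have h1 : Tendsto (fun n => (F n - G) p) atTop (𝓝 0) := by
        simpa using (h p).sub_const (G p)
      have h2 := ((Complex.continuous_conj.tendsto 0).comp h1).mul h1 |>.const_mul
        (modeWeight d m p : ℂ)
      simpa [Function.comp_def] using h2
  have := ((Complex.continuous_re.tendsto _).comp hlim).sqrt
  simpa [Function.comp_def] using this

/-- The cutoff function at scale `Λ` has the Fourier transform `χ̂(Λ𝐩)`. -/
lemma chiHat_smul (χ : Space d → ℝ) (hΛ : 0 < Λ) (p : Space d) :
    chiHat χ (Λ • p)
      = ∫ y : Space d, cexp (-I * ⟪p, y⟫_ℝ) * ((Λ ^ (d - 1))⁻¹ * χ (Λ⁻¹ • y) : ℝ) := by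
  have h := Measure.integral_comp_inv_smul (volume : Measure (Space d))
    (fun y => cexp (-I * ⟪Λ • p, y⟫_ℝ) * χ y) Λ
  rw [finrank_euclideanSpace_fin, abs_of_pos (by positivity)] at h
  have hpow : ((Λ ^ (d - 1) : ℝ) : ℂ) ≠ 0 := by
    exact_mod_cast (by positivity : Λ ^ (d - 1) ≠ 0)
  rw [chiHat, ← inv_smul_smul₀ (by positivity : Λ ^ (d - 1) ≠ 0)
    (∫ x : Space d, cexp (-I * ⟪Λ • p, x⟫_ℝ) * χ x), ← h, ← integral_smul]
  refine integral_congr_ae (.of_forall fun y => ?_)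
  simp only [inner_smul_left, inner_smul_right, Complex.real_smul]
  rw [show Λ⁻¹ * ((starRingEnd ℝ) Λ * ⟪p, y⟫_ℝ) = ⟪p, y⟫_ℝ by
    simp only [conj_trivial]; field_simp]
  push_cast
  ring

/-- The regularized delta function at the point `x`, smeared in time with the function `ρ`. -/
def pointTestFn (hχ : IsCutoff χ) (hΛ : 0 < Λ) {ρ : ℝ → ℝ} (hρ : ContDiff ℝ ∞ ρ)
    (hρc : HasCompactSupport ρ) (x : Minkowski d) : TestFn d where
  toFun z := ρ (x.1 - z.1) * ((Λ ^ (d - 1))⁻¹ * χ (Λ⁻¹ • (z.2 - x.2)))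
  contDiff' := by
    have := hχ.contDiff
    exact (hρ.comp (contDiff_const.sub contDiff_fst)).mul (contDiff_const.mul
      (this.comp ((contDiff_snd.sub contDiff_const).const_smul Λ⁻¹)))
  hasCompactSupport' := by
    have h1 := hρc.comp_homeomorph (Homeomorph.subLeft x.1)
    have h2 := hχ.hasCompactSupport.comp_homeomorph
      ((Homeomorph.subRight x.2).trans (Homeomorph.smulOfNeZero Λ⁻¹ (inv_ne_zero hΛ.ne')))
    refine HasCompactSupport.intro (h1.isCompact.prod h2.isCompact) fun z hz => ?_
    rw [Set.mem_prod, not_and_or] at hz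
    rcases hz with hz | hz
    · have := image_eq_zero_of_notMem_tsupport hz
      simp only [Function.comp_apply, Homeomorph.subLeft_apply] at this
      rw [this, zero_mul]
    · have := image_eq_zero_of_notMem_tsupport hz
      simp only [Function.comp_apply, Homeomorph.trans_apply, Homeomorph.subRight_apply,
        Homeomorph.smulOfNeZero_apply] at this
      rw [this, mul_zero, mul_zero]
  tsupport_subset' := by simp

lemma shell_pointTestFn (hχ : IsCutoff χ) (hΛ : 0 < Λ) {ρ : ℝ → ℝ} (hρ : ContDiff ℝ ∞ ρ)
    (hρc : HasCompactSupport ρ) (x : Minkowski d) (p : Space d) :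
    shell m (pointTestFn hχ hΛ hρ hρc x) p
      = (∫ s, ρ (x.1 - s) • cexp (I * (energy m p * s : ℝ)))
        * (cexp (-I * ⟪p, x.2⟫_ℝ) * chiHat χ (Λ • p)) := by
  have hspace : ∫ y : Space d,
      cexp (-I * ⟪p, y⟫_ℝ) * ((Λ ^ (d - 1))⁻¹ * χ (Λ⁻¹ • (y - x.2)) : ℝ)
      = cexp (-I * ⟪p, x.2⟫_ℝ) * chiHat χ (Λ • p) := by
    rw [chiHat_smul χ hΛ, ← integral_const_mul, ← integral_sub_right_eq_self (fun y : Space d =>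
      cexp (-I * ⟪p, x.2⟫_ℝ) * (cexp (-I * ⟪p, y⟫_ℝ) * ((Λ ^ (d - 1))⁻¹ * χ (Λ⁻¹ • y) : ℝ))) x.2]
    refine integral_congr_ae (.of_forall fun y => ?_)
    simp only [inner_sub_right]
    rw [← mul_assoc (cexp (-I * ⟪p, x.2⟫_ℝ)), ← Complex.exp_add]
    congr 2
    push_cast
    ring
  rw [← hspace, ← integral_prod_mul, shell, ← Measure.volume_eq_prod]
  refine integral_congr_ae (.of_forall fun z => ?_)
  have h1 : (pointTestFn hχ hΛ hρ hρc x : TestFn d) z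
    = ρ (x.1 - z.1) * ((Λ ^ (d - 1))⁻¹ * χ (Λ⁻¹ • (z.2 - x.2))) := rfl
  have h2 : cexp (-I * phaseArg m p z) = cexp (I * (energy m p * z.1 : ℝ))
      * cexp (-I * ⟪p, z.2⟫_ℝ) := by
    rw [← Complex.exp_add, phaseArg]
    congr 1
    push_cast
    ring
  simp only [h1, h2, Complex.real_smul]
  push_cast
  ring

/-- The one-particle vector of the regularized field at a point is the limit of those of the test
functions `pointTestFn` when `ρ` tends to the delta function. -/
lemma pointVec_mem (hm : 0 < m) (hχ : IsCutoff χ) (hΛ : 0 < Λ) (x : Minkowski d) :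
    pointVec hm hχ hΛ x ∈ WeylSystem.closedRange (shellVec d hm) := by
  let φ : ℕ → ContDiffBump (0 : ℝ) := fun n =>
    ⟨1 / (n + 1), 2 / (n + 1), by positivity, by gcongr; norm_num⟩
  have hφ : Tendsto (fun n => (φ n).rOut) atTop (𝓝 0) := by
    have := (tendsto_one_div_add_atTop_nhds_zero_nat (𝕜 := ℝ)).const_mul 2
    simp only [mul_zero] at this
    refine this.congr fun n => ?_
    simp only [φ]
    ring
  let h : ℕ → TestFn d := fun n => pointTestFn hχ hΛ ((φ n).contDiff_normed (μ := volume))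
    (φ n).hasCompactSupport_normed x
  obtain ⟨s, hs⟩ := exists_schwartz_chiHat hχ hΛ
  have hcont : Continuous (pointMode m χ Λ x) := by
    have h1 := chiHat_smul_continuous hχ hΛ
    have h2 := (phaseArg_continuous m).comp (Continuous.prodMk_left x)
    simp only [Function.comp_def] at h2
    unfold pointMode
    fun_prop
  have hconv : ∀ p, Tendsto (fun n => shell m (h n) p) atTop (𝓝 (pointMode m χ Λ x p)) := by
    intro p
    have he : Continuous fun s : ℝ => cexp (I * (energy m p * s : ℝ)) := by fun_prop
    have h1 := ContDiffBump.convolution_tendsto_right (μ := volume) (φ := φ)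
      (g := fun _ s => cexp (I * (energy m p * s : ℝ))) (k := fun _ => x.1) hφ
      (.of_forall fun _ => he.aestronglyMeasurable)
      ((he.tendsto x.1).comp tendsto_snd) tendsto_const_nhds
    simp only [convolution_lsmul_swap] at h1
    have h2 := h1.mul_const (cexp (-I * ⟪p, x.2⟫_ℝ) * chiHat χ (Λ • p))
    simp only [h, shell_pointTestFn]
    convert h2 using 2
    rw [pointMode, ← mul_assoc, ← Complex.exp_add, phaseArg]
    congr 2
    push_cast
    ring
  have hbound : ∀ n p, ‖shell m (h n) p‖ ≤ ‖s p‖ := by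
    intro n p
    simp only [h, shell_pointTestFn]
    rw [norm_mul, norm_mul, norm_exp_neg_I_mul, one_mul, hs]
    refine mul_le_of_le_one_left (norm_nonneg _) ((norm_integral_le_integral_norm _).trans ?_)
    simp only [norm_smul, norm_exp_I_mul, mul_one, Real.norm_of_nonneg ((φ n).nonneg_normed _)]
    rw [integral_sub_left_eq_self (fun s => (φ n).normed volume s), (φ n).integral_normed]
  refine mem_closure_of_tendsto (tendsto_toLp_onShell hm (fun n => memLp_shell hm (h n))
    (memLp_pointMode hm hχ hΛ x) (fun n => shell_continuous m (h n)) hcont hbound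
    (fun p => ?_) hconv) (.of_forall fun n => ⟨h n, rfl⟩)
  rw [pointMode, norm_mul, norm_exp_neg_I_mul, one_mul, hs]

end Approximation

/-! ### Matrix elements in the vacuum representation -/

/-- Matrix elements of Weyl operators between coherent vectors. -/
lemma WeylSystem.inner_op_vac_op_op_vac {T K H : Type*} [AddCommGroup T] [NormedAddCommGroup K]
    [InnerProductSpace ℂ K] {j : T →+ K} [NormedAddCommGroup H] [InnerProductSpace ℂ H]
    (w : WeylSystem j H) (k v h : T) :
    ⟪w.op k w.vac, w.op v (w.op h w.vac)⟫_ℂ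
      = cexp (-(1 / 2) * ⟪j k, j k⟫_ℂ - (1 / 2) * ⟪j h, j h⟫_ℂ + ⟪j k, j h⟫_ℂ)
        * cexp (-(1 / 2) * ⟪j v, j v⟫_ℂ - ⟪j v, j h⟫_ℂ + ⟪j k, j v⟫_ℂ) := by
  rw [w.op_op, inner_smul_right, inner_op_vac_op_vac, ← Complex.exp_add, ← Complex.exp_add]
  congr 1
  have h1 : (((⟪j v, j h⟫_ℂ).im : ℝ) : ℂ) * I = (⟪j v, j h⟫_ℂ - ⟪j h, j v⟫_ℂ) / 2 := by
    rw [← inner_conj_symm (j h) (j v), Complex.sub_conj]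
    push_cast
    ring
  simp only [map_add, inner_add_left, inner_add_right]
  linear_combination -h1

lemma WeylSystem.inner_extend_op {T K H : Type*} [AddCommGroup T] [NormedAddCommGroup K]
    [InnerProductSpace ℂ K] {j : T →+ K} [NormedAddCommGroup H] [InnerProductSpace ℂ H]
    [CompleteSpace H] (w : WeylSystem j H) (k h : T) (u : closedRange j) :
    ⟪w.op k w.vac, w.extend.op u (w.op h w.vac)⟫_ℂ
      = cexp (-(1 / 2) * ⟪j k, j k⟫_ℂ - (1 / 2) * ⟪j h, j h⟫_ℂ + ⟪j k, j h⟫_ℂ)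
        * cexp (-(1 / 2) * ⟪(u : K), (u : K)⟫_ℂ - ⟪(u : K), j h⟫_ℂ + ⟪j k, (u : K)⟫_ℂ) := by
  rw [← w.extend_op k, ← w.extend_op h]
  exact w.extend.inner_op_vac_op_op_vac _ u _

section Vacuum

variable {d : ℕ} {m : ℝ} {hm : 0 < m} {H : Type*} [NormedAddCommGroup H]
  [InnerProductSpace ℂ H] [CompleteSpace H]

/-- The Weyl system of the GNS representation of the vacuum. -/
def vacuumWeyl (T : GNSTriple (vacuumState d hm) H) : WeylSystem (shellVec d hm) H where
  op h := T.rep (WeylAlgebra.W hm h)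
  op_op f g ξ := by
    rw [← ContinuousLinearMap.comp_apply, ← ContinuousLinearMap.mul_def, ← map_mul,
      WeylAlgebra.W_mul_W, map_smul, smul_apply, inner_shellVec, weylPhase, causalProp]
    congr 2
    push_cast
    ring
  op_zero ξ := by
    rw [← WeylAlgebra.one_def, map_one, one_apply_eq_self]
  inner_op_left f ξ η := by
    rw [← WeylAlgebra.star_W, map_star, ContinuousLinearMap.star_eq_adjoint,
      ContinuousLinearMap.adjoint_inner_right]
  vac := T.vac
  inner_vac f := by rw [T.inner_rep, vacuumState_W, inner_shellVec]
  total := by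
    refine T.cyclic.mono ?_
    rintro _ ⟨a, rfl⟩
    induction a using WeylAlgebra.induction_W with
    | hz => simp
    | ha a b h h' =>
      simp only [map_add, add_apply]
      exact Submodule.add_mem _ h h'
    | hW c h =>
      simp only [map_smul, smul_apply]
      exact Submodule.smul_mem _ _ (Submodule.subset_span ⟨h, rfl⟩)

lemma inner_extend_op_vac (T : GNSTriple (vacuumState d hm) H) (h k : TestFn d)
    (u : WeylSystem.closedRange (shellVec d hm)) :
    ⟪T.rep (WeylAlgebra.W hm k) T.vac,
        (vacuumWeyl T).extend.op u (T.rep (WeylAlgebra.W hm h) T.vac)⟫_ℂ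
      = cexp (-(1 / 2) * twoPoint m k k - (1 / 2) * twoPoint m h h + twoPoint m k h)
        * cexp (-(1 / 2) * ⟪(u : OneParticle d), (u : OneParticle d)⟫_ℂ
          - ⟪(u : OneParticle d), shellVec d hm h⟫_ℂ
          + ⟪shellVec d hm k, (u : OneParticle d)⟫_ℂ) := by
  have hmat := (vacuumWeyl T).inner_extend_op k h u
  rw [inner_shellVec, inner_shellVec, inner_shellVec] at hmat
  exact hmat

end Vacuum

/-! ### The regularized field on the shifted configurations -/

section Fubini

lemma integrable_mul_mul_of_norm_eq_one {X Y : Type*} [TopologicalSpace X]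
    [SecondCountableTopology X] [MeasureSpace X] [OpensMeasurableSpace X] [TopologicalSpace Y]
    [SecondCountableTopology Y] [MeasureSpace Y] [OpensMeasurableSpace Y]
    [SFinite (volume : Measure X)] [SFinite (volume : Measure Y)] {c : X → ℂ} {b : Y → ℂ}
    (hc : Integrable c) (hb : Integrable b) {E : X → Y → ℂ} (hE : Continuous (Function.uncurry E))
    (hE1 : ∀ x y, ‖E x y‖ = 1) :
    Integrable (Function.uncurry fun x y => c x * (b y * E x y)) (volume.prod volume) := by
  refine ((hc.mul_prod hb).mul_bdd (c := 1) hE.aestronglyMeasurable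
    (.of_forall fun p => (hE1 p.1 p.2).le)).congr (.of_forall fun p => ?_)
  simp only [Function.uncurry]
  ring

variable {d : ℕ} {m : ℝ}

lemma integrable_modeWeight_mul_shell (hm : 0 < m) (h : TestFn d) :
    Integrable fun p : Space d => (modeWeight d m p : ℂ) * shell m h p := by
  obtain ⟨C, hC0, hC⟩ := shell_decay m h (d + 1)
  have hint := (integrable_one_add_norm (E := Space d) (μ := volume) (r := ((d + 1 : ℕ) : ℝ)) (by
    rw [finrank_euclideanSpace_fin]; exact_mod_cast (by omega : d - 1 < d + 1))).const_mul
      (1 / ((2 * Real.pi) ^ (d - 1) * (2 * m)) * C)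
  have h1 := modeWeight_continuous (d := d) hm
  have h2 := shell_continuous m h
  refine hint.mono' (Continuous.aestronglyMeasurable (by fun_prop)) (.of_forall fun p => ?_)
  have hf : ‖shell m h p‖ ≤ C * (1 + ‖p‖) ^ (-((d + 1 : ℕ) : ℝ)) := by
    rw [Real.rpow_neg (by positivity), Real.rpow_natCast, ← div_eq_mul_inv,
      le_div_iff₀ (by positivity), mul_comm]
    exact hC p
  rw [norm_mul, Complex.norm_of_nonneg (modeWeight_nonneg m p), mul_assoc]
  gcongr
  exact modeWeight_le hm p

lemma conj_deltaRight (h : TestFn d) (x : Minkowski d) :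
    conj (deltaRight m h x) = deltaLeft m h x := by
  rw [deltaRight, deltaLeft, ← integral_conj]
  refine integral_congr_ae (.of_forall fun p => ?_)
  simp only [map_mul, Complex.conj_ofReal, ← Complex.exp_conj, Complex.conj_I]
  ring

variable {χ : Space d → ℝ} {Λ : ℝ}

lemma integrable_cutoff (hχ : IsCutoff χ) (hΛ : 0 < Λ) :
    Integrable fun y : Space d => (((Λ ^ (d - 1))⁻¹ * χ (Λ⁻¹ • y) : ℝ) : ℂ) := by
  have h1 : Integrable χ := hχ.contDiff.continuous.integrable_of_hasCompactSupport
    hχ.hasCompactSupport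
  exact ((h1.comp_smul (inv_ne_zero hΛ.ne')).const_mul _).ofReal

lemma continuous_exp_phaseArg_sub (m : ℝ) (x : Minkowski d) :
    Continuous (Function.uncurry fun (y p : Space d) =>
      cexp (I * phaseArg m p (x.1, x.2 - y))) := by
  have h := (phaseArg_continuous (d := d) m).comp (f := fun q : Space d × Space d =>
    (q.2, (x.1, x.2 - q.1))) (by fun_prop)
  simp only [Function.comp_def] at h
  unfold Function.uncurry
  fun_prop

lemma integrable_cutoff_mul_deltaRight (hm : 0 < m) (hχ : IsCutoff χ) (hΛ : 0 < Λ) (h : TestFn d)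
    (x : Minkowski d) :
    Integrable fun y : Space d =>
      (((Λ ^ (d - 1))⁻¹ * χ (Λ⁻¹ • y) : ℝ) : ℂ) * deltaRight m h (x.1, x.2 - y) := by
  have := (integrable_mul_mul_of_norm_eq_one (integrable_cutoff hχ hΛ)
    (integrable_modeWeight_mul_shell hm h) (continuous_exp_phaseArg_sub m x)
    fun y p => norm_exp_I_mul _).integral_prod_left
  refine this.congr (.of_forall fun y => ?_)
  simp only [Function.uncurry, deltaRight]
  rw [← integral_const_mul]
  refine integral_congr_ae (.of_forall fun p => ?_)
  ring

lemma iotaMap_deltaRight (hm : 0 < m) (hχ : IsCutoff χ) (hΛ : 0 < Λ) (h : TestFn d)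
    (x : Minkowski d) :
    iotaMap χ Λ (deltaRight m h) x = ⟪pointVec hm hχ hΛ x, shellVec d hm h⟫_ℂ := by
  have hswap := integral_integral_swap (integrable_mul_mul_of_norm_eq_one (integrable_cutoff hχ hΛ)
    (integrable_modeWeight_mul_shell hm h) (continuous_exp_phaseArg_sub m x)
    fun y p => norm_exp_I_mul _)
  have h1 : iotaMap χ Λ (deltaRight m h) x = ∫ y : Space d, ∫ p : Space d,
      (((Λ ^ (d - 1))⁻¹ * χ (Λ⁻¹ • y) : ℝ) : ℂ)
        * (((modeWeight d m p : ℂ) * shell m h p) * cexp (I * phaseArg m p (x.1, x.2 - y))) := by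
    rw [iotaMap]
    refine integral_congr_ae (.of_forall fun y => ?_)
    simp only [deltaRight]
    rw [← integral_const_mul]
    refine integral_congr_ae (.of_forall fun p => ?_)
    ring
  rw [h1, hswap, pointVec, shellVec_apply, inner_toLp_onShell]
  refine integral_congr_ae (.of_forall fun p => ?_)
  simp only [pointMode, map_mul, conj_chiHat hχ, ← Complex.exp_conj]
  rw [chiHat_smul χ hΛ]
  simp only [← integral_const_mul, ← integral_mul_const]
  refine integral_congr_ae (.of_forall fun y => ?_)
  have h2 : cexp (I * phaseArg m p (x.1, x.2 - y))
      = cexp (I * phaseArg m p x) * cexp (-I * ⟪p, y⟫_ℝ) := by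
    rw [← Complex.exp_add]
    congr 1
    simp only [phaseArg, inner_sub_right]
    push_cast
    ring
  simp only [h2, map_neg, Complex.conj_I, neg_neg, Complex.conj_ofReal]
  ring

/-- The regularized field at `x` on the configuration `i (Δ₊ h) - i (k Δ₊)`, which is where the
products with `W₊(h)` and `W₊(k)*` evaluate a functional. -/
lemma iotaMap_shift (hm : 0 < m) (hχ : IsCutoff χ) (hΛ : 0 < Λ) (h k : TestFn d)
    (x : Minkowski d) :
    iotaMap χ Λ (0 + I • deltaLeft m (-k) + I • deltaRight m h) x
      = I * (⟪pointVec hm hχ hΛ x, shellVec d hm h⟫_ℂ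
        - ⟪shellVec d hm k, pointVec hm hχ hΛ x⟫_ℂ) := by
  have hR := integrable_cutoff_mul_deltaRight hm hχ hΛ h x
  have hL : Integrable fun y : Space d =>
      (((Λ ^ (d - 1))⁻¹ * χ (Λ⁻¹ • y) : ℝ) : ℂ) * deltaLeft m (-k) (x.1, x.2 - y) := by
    have h0 := integrable_cutoff_mul_deltaRight hm hχ hΛ (-k) x
    refine (h0.norm.mono' (Complex.continuous_conj.comp_aestronglyMeasurable
      h0.aestronglyMeasurable) (.of_forall fun y => by simp)).congr (.of_forall fun y => ?_)
    simp only [map_mul, Complex.conj_ofReal, conj_deltaRight]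
  have hLval : ∫ y : Space d,
      (((Λ ^ (d - 1))⁻¹ * χ (Λ⁻¹ • y) : ℝ) : ℂ) * deltaLeft m (-k) (x.1, x.2 - y)
      = -⟪shellVec d hm k, pointVec hm hχ hΛ x⟫_ℂ := by
    have h0 := congrArg conj (iotaMap_deltaRight hm hχ hΛ (-k) x)
    rw [inner_conj_symm, map_neg, inner_neg_left, iotaMap, ← integral_conj] at h0
    rw [← h0]
    refine integral_congr_ae (.of_forall fun y => ?_)
    simp only [map_mul, Complex.conj_ofReal, conj_deltaRight]
  have hRval := iotaMap_deltaRight hm hχ hΛ h x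
  rw [iotaMap] at hRval
  rw [mul_sub, sub_eq_add_neg, ← mul_neg, ← hLval, ← hRval, ← integral_const_mul,
    ← integral_const_mul, ← integral_add (hR.const_mul I) (hL.const_mul I), iotaMap]
  refine integral_congr_ae (.of_forall fun y => ?_)
  simp only [Pi.add_apply, Pi.zero_apply, Pi.smul_apply, smul_eq_mul]
  ring

lemma integral_mul_deltaLeft (hm : 0 < m) (h k : TestFn d) :
    ∫ x : Minkowski d, (h x : ℂ) * deltaLeft m k x = twoPoint m k h := by
  have hh : Integrable fun x : Minkowski d => ((h x : ℝ) : ℂ) :=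
    (h.continuous.integrable_of_hasCompactSupport h.hasCompactSupport).ofReal
  have hk := integrable_modeWeight_mul_shell hm k
  have hk' : Integrable fun p : Space d => (modeWeight d m p : ℂ) * conj (shell m k p) :=
    (hk.norm.mono' (Complex.continuous_conj.comp_aestronglyMeasurable hk.aestronglyMeasurable)
      (.of_forall fun p => by simp)).congr (.of_forall fun p => by simp)
  have hE : Continuous (Function.uncurry fun (x : Minkowski d) (p : Space d) =>
      cexp (-I * phaseArg m p x)) := by
    have h := (phaseArg_continuous (d := d) m).comp continuous_swap
    simp only [Function.comp_def] at h
    unfold Function.uncurry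
    fun_prop
  have hswap := integral_integral_swap (integrable_mul_mul_of_norm_eq_one hh hk' hE
    fun x p => norm_exp_neg_I_mul _)
  have h1 : ∫ x : Minkowski d, (h x : ℂ) * deltaLeft m k x
      = ∫ x : Minkowski d, ∫ p : Space d, ((h x : ℝ) : ℂ)
        * (((modeWeight d m p : ℂ) * conj (shell m k p)) * cexp (-I * phaseArg m p x)) := by
    refine integral_congr_ae (.of_forall fun x => ?_)
    simp only [deltaLeft]
    rw [← integral_const_mul]
    refine integral_congr_ae (.of_forall fun p => ?_)
    ring
  rw [h1, hswap, twoPoint]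
  refine integral_congr_ae (.of_forall fun p => ?_)
  simp only [shell]
  rw [← integral_const_mul, ← integral_const_mul]
  refine integral_congr_ae (.of_forall fun x => ?_)
  ring

/-- The vacuum expectation value of `W₊(k)* ⋆ r_Λ F ⋆ W₊(h)`. -/
lemma starWeyl_pullback (hm : 0 < m) (hχ : IsCutoff χ) (hΛ : 0 < Λ) (F : Functional d)
    (h k : TestFn d) :
    starWeylLeft m (-k) (starWeylRight m (pullback χ Λ F) h) 0
      = cexp (-(1 / 2) * twoPoint m k k - (1 / 2) * twoPoint m h h + twoPoint m k h)
        * F fun x => I * (⟪pointVec hm hχ hΛ x, shellVec d hm h⟫_ℂ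
          - ⟪shellVec d hm k, pointVec hm hχ hΛ x⟫_ℂ) := by
  have hfield : field h (0 + I • deltaLeft m (-k)) = -I * twoPoint m k h := by
    rw [field]
    have h1 := integral_mul_deltaLeft hm h (-k)
    rw [twoPoint_neg_left hm] at h1
    rw [neg_mul, ← mul_neg, ← h1, ← integral_const_mul]
    refine integral_congr_ae (.of_forall fun x => ?_)
    simp only [Pi.add_apply, Pi.zero_apply, Pi.smul_apply, smul_eq_mul]
    ring
  have hzero : field (-k) 0 = 0 := by simp [field]
  have hconf := funext (iotaMap_shift hm hχ hΛ h k)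
  rw [starWeylLeft, starWeylRight, pullback, hconf, weylFunctional, weylFunctional, hfield, hzero,
    twoPoint_neg_left hm, twoPoint_neg_right hm, neg_neg, mul_zero, Complex.exp_zero, one_mul,
    mul_comm (F _), ← mul_assoc, ← Complex.exp_add, ← Complex.exp_add]
  congr 2
  linear_combination (-twoPoint m k h) * Complex.I_mul_I

end Fubini

/-! ### The S-matrix -/

lemma sum_sum_eq_of_symm {n : ℕ} {F : Fin n → Fin n → ℂ} (hF : ∀ i k, F i k = F k i) :
    ∑ i, ∑ k, F i k = ∑ i, F i i + 2 * ∑ j, ∑ l ∈ Finset.Iio j, F l j := by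
  have h1 : ∀ j, ∑ l, F l j = ∑ l ∈ Finset.Iio j, F l j + F j j + ∑ l ∈ Finset.Ioi j, F l j := by
    intro j
    have h2 : (Finset.univ : Finset (Fin n)) = insert j (Finset.Iio j ∪ Finset.Ioi j) := by
      ext l
      simpa [or_comm, or_assoc, or_left_comm, eq_comm] using lt_trichotomy l j
    have h3 : Disjoint (Finset.Iio j) (Finset.Ioi j) :=
      Finset.disjoint_left.2 fun l h h' => lt_asymm (Finset.mem_Iio.1 h) (Finset.mem_Ioi.1 h')
    rw [h2, Finset.sum_insert (by simp), Finset.sum_union h3]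
    ring
  have h4 : ∑ j, ∑ l ∈ Finset.Ioi j, F l j = ∑ j, ∑ l ∈ Finset.Iio j, F l j := by
    rw [Finset.sum_comm' (t' := Finset.univ) (s' := fun l => Finset.Iio l) (by simp)]
    exact Finset.sum_congr rfl fun l _ => Finset.sum_congr rfl fun j _ => hF _ _
  rw [Finset.sum_comm]
  simp only [h1, Finset.sum_add_distrib, h4]
  ring

/-- The algebra of the exponents in `coeff_mul_inner`: `N` and `E` are the diagonal and the
off-diagonal part of the sum of Feynman propagators, `A` and `D` its real and imaginary part. -/
lemma exp_feynman_identity (P Q S B C : ℂ) {A D E N : ℂ} (h : N + 2 * E = A + I * D) :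
    P * (Q * cexp (1 / 2 * N)) * cexp (-(I / 2) * D) * (S * cexp (-(1 / 2) * A - B + C))
      = S * (P * (cexp (-B + C) * Q * cexp (-E))) := by
  have hexp : cexp (1 / 2 * N) * cexp (-(I / 2) * D) * cexp (-(1 / 2) * A - B + C)
      = cexp (-B + C) * cexp (-E) := by
    rw [← Complex.exp_add, ← Complex.exp_add, ← Complex.exp_add]
    congr 1
    linear_combination (1 / 2) * h
  linear_combination (S * P * Q) * hexp

section SMatrix

variable {d : ℕ} {m : ℝ} {χ : Space d → ℝ} {Λ : ℝ}

/-- The vertex of the interaction `L_I(f, g)`, parametrized by the pairs `(a, x)`. The functional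
`e^{iaφ(x)}` stands for the normal ordered exponential, which is the Weyl operator times
`e^{a² Δ_{+,Λ}(0) / 2}`; this factor is part of the weight. -/
def interactionVertex (hm : 0 < m) (hχ : IsCutoff χ) (hΛ : 0 < Λ) (f : 𝓢(ℝ, ℂ))
    (hfW : Integrable fun a : ℝ => ‖f a‖ * Real.exp (a ^ 2 / 2 * (regTwoPoint m χ Λ 0).re))
    (g : TestFn d) :
    Vertex (WeylSystem.closedRange (shellVec d hm)) (ℝ × Minkowski d) where
  vec z := ⟨(z.1 : ℂ) • pointVec hm hχ hΛ z.2,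
    smul_mem_closedRange hm z.1 (pointVec_mem hm hχ hΛ z.2)⟩
  continuous_vec := Continuous.subtype_mk (by
    have := continuous_pointVec hm hχ hΛ
    fun_prop) _
  weight z := f z.1 * Real.exp (z.1 ^ 2 / 2 * (regTwoPoint m χ Λ 0).re) * g z.2
  integrable_weight := by
    have h1 : Integrable fun a : ℝ =>
        f a * (Real.exp (a ^ 2 / 2 * (regTwoPoint m χ Λ 0).re) : ℂ) := by
      have := f.continuous
      refine hfW.mono' (Continuous.aestronglyMeasurable (by fun_prop)) (.of_forall fun a => ?_)
      rw [norm_mul, Complex.norm_of_nonneg (Real.exp_pos _).le]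
    exact h1.mul_prod (g.continuous.integrable_of_hasCompactSupport g.hasCompactSupport).ofReal

/-- The imaginary part of the Feynman propagator, with the coupling constants of the vertices. -/
def feynmanPhase (m : ℝ) (χ : Space d → ℝ) (Λ : ℝ) (z z' : ℝ × Minkowski d) : ℝ :=
  z.1 * z'.1 * (regFeynman m χ Λ (z.2 - z'.2)).im

lemma feynmanPhase_continuous (hm : 0 < m) (hχ : IsCutoff χ) (hΛ : 0 < Λ) :
    Continuous (Function.uncurry (feynmanPhase m χ Λ)) := by
  have := regFeynman_continuous hm hχ hΛ
  unfold Function.uncurry feynmanPhase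
  fun_prop

variable (hm : 0 < m) (hχ : IsCutoff χ) (hΛ : 0 < Λ) (f : 𝓢(ℝ, ℂ))
  (hfW : Integrable fun a : ℝ => ‖f a‖ * Real.exp (a ^ 2 / 2 * (regTwoPoint m χ Λ 0).re))
  (g : TestFn d)

lemma re_regTwoPoint_zero (hm : 0 < m) (hχ : IsCutoff χ) (hΛ : 0 < Λ) :
    ((regTwoPoint m χ Λ 0).re : ℂ) = regFeynman m χ Λ 0 := by
  have h := inner_pointVec hm hχ hΛ (0 : Minkowski d) 0
  rw [sub_self] at h
  have h1 : (regTwoPoint m χ Λ 0).im = 0 := by rw [← h, WeylSystem.im_inner_self]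
  have h2 : regFeynman m χ Λ 0 = regTwoPoint m χ Λ 0 := by simp [regFeynman]
  rw [h2]
  exact Complex.ext (by simp) (by simp [h1])

lemma coe_vec (z : ℝ × Minkowski d) :
    ((interactionVertex hm hχ hΛ f hfW g).vec z : OneParticle d)
      = (z.1 : ℂ) • pointVec hm hχ hΛ z.2 := rfl

lemma coe_totalVec {n : ℕ} (z : Fin n → ℝ × Minkowski d) :
    ((interactionVertex hm hχ hΛ f hfW g).totalVec z : OneParticle d)
      = ∑ i, ((z i).1 : ℂ) • pointVec hm hχ hΛ (z i).2 := by
  rw [Vertex.totalVec, AddSubgroup.val_finsetSum]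
  exact Finset.sum_congr rfl fun i _ => coe_vec hm hχ hΛ f hfW g (z i)

/-- The sum of the Feynman propagators between all vertices: its real part is the squared norm of the
total one-particle vector, its imaginary part the phase of the time-ordered product. -/
lemma sum_sum_regFeynman {n : ℕ} (z : Fin n → ℝ × Minkowski d) :
    ∑ i, ∑ k, ((z i).1 * (z k).1 * regFeynman m χ Λ ((z i).2 - (z k).2) : ℂ)
      = ⟪((interactionVertex hm hχ hΛ f hfW g).totalVec z : OneParticle d),
          ((interactionVertex hm hχ hΛ f hfW g).totalVec z : OneParticle d)⟫_ℂ
        + I * (∑ i, ∑ k, feynmanPhase m χ Λ (z i) (z k) : ℝ) := by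
  have hre : ∀ x : OneParticle d, ⟪x, x⟫_ℂ = ((⟪x, x⟫_ℂ).re : ℂ) := fun x =>
    Complex.ext (by rw [Complex.ofReal_re])
      (by rw [Complex.ofReal_im, WeylSystem.im_inner_self])
  rw [hre, coe_totalVec]
  simp only [sum_inner, inner_sum, inner_smul_left, inner_smul_right, Complex.re_sum,
    Complex.conj_ofReal, Complex.re_ofReal_mul, ← re_regFeynman hm hχ hΛ]
  push_cast
  simp only [Finset.mul_sum, ← Finset.sum_add_distrib]
  refine Finset.sum_congr rfl fun i _ => Finset.sum_congr rfl fun k _ => ?_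
  rw [feynmanPhase, regFeynman_swap hχ (z k).2]
  conv_lhs => rw [← Complex.re_add_im (regFeynman m χ Λ _)]
  push_cast
  ring

/-- The integrand of the ordered product of vertices, between coherent vectors, is the integrand of
the time-ordered product on the shifted configuration. -/
lemma coeff_mul_inner {H : Type*} [NormedAddCommGroup H] [InnerProductSpace ℂ H] [CompleteSpace H]
    (T : GNSTriple (vacuumState d hm) H) (h k : TestFn d) {n : ℕ}
    (z : Fin n → ℝ × Minkowski d) :
    (interactionVertex hm hχ hΛ f hfW g).coeff (feynmanPhase m χ Λ) z *
        ⟪T.rep (WeylAlgebra.W hm k) T.vac, (vacuumWeyl T).extend.op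
          ((interactionVertex hm hχ hΛ f hfW g).totalVec z) (T.rep (WeylAlgebra.W hm h) T.vac)⟫_ℂ
      = cexp (-(1 / 2) * twoPoint m k k - (1 / 2) * twoPoint m h h + twoPoint m k h) *
        ((∏ i, f (z i).1) * ((∏ i, cexp (I * (z i).1 *
            (I * (⟪pointVec hm hχ hΛ (z i).2, shellVec d hm h⟫_ℂ
              - ⟪shellVec d hm k, pointVec hm hχ hΛ (z i).2⟫_ℂ))) * g (z i).2) *
          cexp (-∑ j, ∑ l ∈ Finset.Iio j,
            (z l).1 * (z j).1 * regFeynman m χ Λ ((z l).2 - (z j).2)))) := by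
  set v := interactionVertex hm hχ hΛ f hfW g with hv
  have hvec : (v.totalVec z : OneParticle d) = ∑ i, ((z i).1 : ℂ) • pointVec hm hχ hΛ (z i).2 :=
    coe_totalVec hm hχ hΛ f hfW g z
  have hlin : -⟪(v.totalVec z : OneParticle d), shellVec d hm h⟫_ℂ
      + ⟪shellVec d hm k, (v.totalVec z : OneParticle d)⟫_ℂ
      = ∑ i, I * (z i).1 * (I * (⟪pointVec hm hχ hΛ (z i).2, shellVec d hm h⟫_ℂ
              - ⟪shellVec d hm k, pointVec hm hχ hΛ (z i).2⟫_ℂ)) := by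
    rw [hvec, sum_inner, inner_sum, ← Finset.sum_neg_distrib, ← Finset.sum_add_distrib]
    refine Finset.sum_congr rfl fun i _ => ?_
    rw [inner_smul_left, inner_smul_right, Complex.conj_ofReal]
    linear_combination (-((z i).1 : ℂ) * (⟪pointVec hm hχ hΛ (z i).2, shellVec d hm h⟫_ℂ
      - ⟪shellVec d hm k, pointVec hm hχ hΛ (z i).2⟫_ℂ)) * Complex.I_mul_I
  have hquad := sum_sum_regFeynman hm hχ hΛ f hfW g z
  rw [sum_sum_eq_of_symm fun i k => by rw [regFeynman_swap hχ, mul_comm ((z i).1 : ℂ)], ← hv]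
    at hquad
  simp only [sub_self] at hquad
  have hweight : ∏ i, v.weight (z i) = (∏ i, f (z i).1) * ((∏ i, (g (z i).2 : ℂ)) *
      cexp (∑ i, (z i).1 ^ 2 / 2 * regFeynman m χ Λ 0)) := by
    rw [Complex.exp_sum, ← Finset.prod_mul_distrib, ← Finset.prod_mul_distrib]
    refine Finset.prod_congr rfl fun i _ => ?_
    simp only [hv, interactionVertex, ← re_regTwoPoint_zero hm hχ hΛ]
    push_cast
    ring
  have hhalf : ∑ i, ((z i).1 : ℂ) ^ 2 / 2 * regFeynman m χ Λ 0
      = (1 / 2) * ∑ i, ((z i).1 : ℂ) * (z i).1 * regFeynman m χ Λ 0 := by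
    rw [Finset.mul_sum]
    exact Finset.sum_congr rfl fun i _ => by ring
  rw [inner_extend_op_vac, Vertex.coeff, hweight, Finset.prod_mul_distrib, ← Complex.exp_sum,
    ← hlin]
  rw [hhalf]
  exact exp_feynman_identity _ _ _ _ _ hquad

/-- The terms of the Dyson series represent the terms of the regularized S-matrix. -/
lemma represents_expTerm {H : Type*} [NormedAddCommGroup H] [InnerProductSpace ℂ H]
    [CompleteSpace H] (T : GNSTriple (vacuumState d hm) H) (n : ℕ) :
    Represents T (pullback χ Λ (sMatrixTerm m χ Λ f g n))
      ((interactionVertex hm hχ hΛ f hfW g).expTerm (vacuumWeyl T).extend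
        (feynmanPhase_continuous hm hχ hΛ) I n) := by
  intro h k
  set v := interactionVertex hm hχ hΛ f hfW g with hv
  set ξ := T.rep (WeylAlgebra.W hm h) T.vac
  set η := T.rep (WeylAlgebra.W hm k) T.vac
  have hθ := feynmanPhase_continuous (d := d) hm hχ hΛ
  have hi : Integrable fun z : Fin n → ℝ × Minkowski d => v.coeff (feynmanPhase m χ Λ) z •
      (vacuumWeyl T).extend.op (v.totalVec z) ξ :=
    (vacuumWeyl T).extend.integrable_smul_op (v.integrable_coeff hθ) v.continuous_totalVec ξ
  -- the integrand as a function of all coupling constants and all points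
  let G : (Fin n → ℝ) × (Fin n → Minkowski d) → ℂ := fun q =>
    cexp (-(1 / 2) * twoPoint m k k - (1 / 2) * twoPoint m h h + twoPoint m k h) *
        ((∏ i, f (q.1 i)) * ((∏ i, cexp (I * q.1 i *
            (I * (⟪pointVec hm hχ hΛ (q.2 i), shellVec d hm h⟫_ℂ
              - ⟪shellVec d hm k, pointVec hm hχ hΛ (q.2 i)⟫_ℂ))) * g (q.2 i)) *
          cexp (-∑ j, ∑ l ∈ Finset.Iio j,
            q.1 l * q.1 j * regFeynman m χ Λ (q.2 l - q.2 j))))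
  have hmp := measurePreserving_arrowProdEquivProdArrow ℝ (Minkowski d) (Fin n)
    (fun _ => volume) (fun _ => volume)
  have hG : ∀ z : Fin n → ℝ × Minkowski d,
      ⟪η, v.coeff (feynmanPhase m χ Λ) z • (vacuumWeyl T).extend.op (v.totalVec z) ξ⟫_ℂ
        = G (MeasurableEquiv.arrowProdEquivProdArrow ℝ (Minkowski d) (Fin n) z) := by
    intro z
    rw [inner_smul_right, hv, coeff_mul_inner]
    rfl
  have hGi : Integrable G ((Measure.pi fun _ => volume).prod (Measure.pi fun _ => volume)) := by
    rw [← hmp.integrable_comp_emb (MeasurableEquiv.measurableEmbedding _)]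
    exact (hi.const_inner η).congr (.of_forall hG)
  rw [starWeyl_pullback hm hχ hΛ, Vertex.expTerm, smul_apply, inner_smul_right, Vertex.ordered,
    WeylSystem.smear_apply, ← integral_inner hi η, sMatrixTerm]
  simp only [hG]
  rw [volume_pi, Measure.volume_eq_prod]
  rw [hmp.integral_comp' G, integral_prod _ hGi, mul_left_comm]
  congr 1
  rw [← integral_const_mul]
  refine integral_congr_ae (.of_forall fun a => ?_)
  simp only [timeOrderedVertex, G]
  rw [integral_const_mul, integral_const_mul]
  rfl

end SMatrix

end ScalarQFT

end

theorem mainTheorem2 (d : ℕ) (hd : 2 ≤ d) (m : ℝ) (hm : 0 < m)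
    (χ : Space d → ℝ) (hχ : IsCutoff χ) (Λ : ℝ) (hΛ : 0 < Λ)
    (f : 𝓢(ℝ, ℂ)) (hf : ∀ a, conj (f a) = f (-a))
    (hfW : Integrable fun a : ℝ => ‖f a‖ * Real.exp (a ^ 2 / 2 * (regTwoPoint m χ Λ 0).re))
    (g : TestFn d)
    {H : Type*} [NormedAddCommGroup H] [InnerProductSpace ℂ H] [CompleteSpace H]
    (T : GNSTriple (vacuumState d hm) H) :
    ∃ S : ℕ → (H →L[ℂ] H),
      (∀ (n : ℕ) (A : H →L[ℂ] H),
        Represents T (pullback χ Λ (sMatrixTerm m χ Λ f g n)) A ↔ A = S n) ∧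
      ∃ U ∈ unitary (H →L[ℂ] H), ∀ ξ : H, HasSum (fun n => S n ξ) (U ξ) := by
  have hθ := feynmanPhase_continuous (d := d) hm hχ hΛ
  refine ⟨(interactionVertex hm hχ hΛ f hfW g).expTerm (vacuumWeyl T).extend hθ Complex.I,
    fun n A => ⟨fun hA => ?_, ?_⟩, ?_⟩
  · refine (vacuumWeyl T).ext_of_matrix_elements fun h k => ?_
    exact (hA h k).trans (represents_expTerm hm hχ hΛ f hfW g T n h k).symm
  · rintro rfl
    exact represents_expTerm hm hχ hΛ f hfW g T n
  -- hermiticity is the symmetry of the integrand under reversal of the coupling constants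
  let e : (ℝ × Minkowski d) ≃ᵐ (ℝ × Minkowski d) :=
    (MeasurableEquiv.neg ℝ).prodCongr (MeasurableEquiv.refl _)
  have he : MeasurePreserving e :=
    (Measure.measurePreserving_neg (volume : Measure ℝ)).prod
      (MeasurePreserving.id (volume : Measure (Minkowski d)))
  have he' : ∀ z, e z = (-z.1, z.2) := fun z => rfl
  have hsymm : ∀ z z', feynmanPhase (d := d) m χ Λ z z' = feynmanPhase m χ Λ z' z := fun z z' => by
    rw [feynmanPhase, feynmanPhase, regFeynman_swap hχ, mul_comm z.1]
  have hcausal : ∀ z z', z'.2.1 ≤ z.2.1 → feynmanPhase m χ Λ z z'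
      = (⟪((interactionVertex hm hχ hΛ f hfW g).vec z : OneParticle d),
        ((interactionVertex hm hχ hΛ f hfW g).vec z' : OneParticle d)⟫_ℂ).im := fun z z' h => by
    rw [feynmanPhase, regFeynman_of_le hm hχ hΛ h, coe_vec, coe_vec, inner_smul_left,
      inner_smul_right, Complex.conj_ofReal, Complex.im_ofReal_mul, Complex.im_ofReal_mul,
      mul_assoc]
  have hvec : ∀ z, (interactionVertex hm hχ hΛ f hfW g).vec (e z)
      = -(interactionVertex hm hχ hΛ f hfW g).vec z := fun z => Subtype.ext <| by
    rw [AddSubgroup.coe_neg, coe_vec, coe_vec, he', Complex.ofReal_neg, neg_smul]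
  have hweight : ∀ z, (interactionVertex hm hχ hΛ f hfW g).weight (e z)
      = conj ((interactionVertex hm hχ hΛ f hfW g).weight z) := fun z => by
    simp only [he', interactionVertex, map_mul, hf, Complex.conj_ofReal, neg_sq]
  have hphase : ∀ z z', feynmanPhase (d := d) m χ Λ (e z) (e z') = feynmanPhase m χ Λ z z' :=
    fun z z' => by simp [he', feynmanPhase]
  obtain ⟨U, hU, hsum⟩ := (interactionVertex hm hχ hΛ f hfW g).exists_unitary_hasSum_expTerm
    (vacuumWeyl T).extend hθ hsymm (fun z => z.2.1) hcausal e he hvec hweight hphase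
  exact ⟨U, hU, fun ξ => hsum.mapL (ContinuousLinearMap.apply ℂ H ξ)⟩
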